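/- **Supra-competitive limiting prices.** Let $N\ge 2$, $a>0$, $b>c>0$, and let $P_{\min},P_{\max}$ satisfy $0<P_{\min}\le p^{NE}<P_{\max}\le a/b$, where $p^{NE}:=\frac{a}{2b-c}$ is the Nash price. For $x\in\mathbb{R}^N$ write $\bar x_{-i}:=\frac1{N-1}\sum_{j\ne i}x_j$, and let $\mathrm{BR}(y):=\frac{a+cy}{2b}$. Let $\mu\in[P_{\min},P_{\max}]^N$ and $\Sigma_{\exp}=\mathrm{diag}(\sigma_1^2,\dots,\sigma_N^2)$ with every $\sigma_i>0$. For $(U,V)\in\mathbb{R}^N\times\mathbb{R}^{N\times N}$ put $\bar V_{i,-i}:=\frac1{N-1}\sum_{j\ne i}V_{ij}$ and define the posted prices $P(U,V)\in[P_{\min},P_{\max}]^N$ by $$\widetilde P_i:=\frac{(a+c\,\bar U_{-i})V_{ii}-c\,U_i\bar V_{i,-i}}{2(bV_{ii}-c\bar V_{i,-i})},\qquad P_i:=\begin{cases}\max\{P_{\min},\min\{\widetilde P_i,P_{\max}\}\}&\text{if }-bV_{ii}+c\bar V_{i,-i}<0,\\ P_{\max}&\text{otherwise.}\end{cases}$$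 The price-moments ODE is the system, for $\tau\ge1$, $$\dot U=\frac{P-U}{\tau},\qquad \dot V=(P-U)(P-U)^\top,\qquad U(1)=\mu,\quad V(1)=\Sigma_{\exp},$$ with $P=P(U(\tau),V(\tau))$ (and a one-sided derivative at $\tau=1$). It has a unique solution on $[1,\infty)$; let $P^{\mathrm{ODE}}(\tau):=P(U(\tau),V(\tau))$ be its posted price vector. Then: (a) if $\mu_i>\mathrm{BR}(\bar\mu_{-i})$ for every $i$ (that is, $\mu\in\mathcal C^+$), then $P^{\mathrm{ODE}}_i(\tau)>p^{NE}$ for every $i$ and every $\tau\in[1,\infty)$; (b) if $\mu_i<\mathrm{BR}(\bar\mu_{-i})$ for every $i$ (that is, $\mu\in\mathcal C^-$), then there is $\tau_0\in[1,\infty)$ such that $P^{\mathrm{ODE}}_i(\tau)>p^{NE}$ for every $i$ and every $\tau>\tau_0$. -/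

import Mathlib

noncomputable section

namespace PriceMoments

/-- Demand parameters and price bounds: firm `i`'s mean demand at prices `p` is
`a - b * p i + c * (average of the other prices)`, and prices lie in `[Pmin, Pmax]`. -/
structure Market where
  a : ℝ
  b : ℝ
  c : ℝ
  Pmin : ℝ
  Pmax : ℝ

/-- The standing assumptions on the demand parameters and the price bounds. -/
structure Market.Admissible (M : Market) : Prop where
  a_pos : 0 < M.a
  c_pos : 0 < M.c
  c_lt_b : M.c < M.b
  Pmin_pos : 0 < M.Pmin
  Pmin_le_nash : M.Pmin ≤ M.a / (2 * M.b - M.c)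
  nash_lt_Pmax : M.a / (2 * M.b - M.c) < M.Pmax
  Pmax_le : M.Pmax ≤ M.a / M.b

/-- The average `(N - 1)⁻¹ ∑_{j ≠ i} x j` over the competitors of `i`. -/
def othersAvg {N : ℕ} (x : Fin N → ℝ) (i : Fin N) : ℝ :=
  (∑ j ∈ Finset.univ.erase i, x j) / ((N : ℝ) - 1)

/-- The best response to the competitors' average price. -/
def Market.BR (M : Market) (pbar : ℝ) : ℝ := (M.a + M.c * pbar) / (2 * M.b)

/-- The symmetric Nash price. -/
def Market.nash (M : Market) : ℝ := M.a / (2 * M.b - M.c)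

/-- `BR` is the unique maximizer of the profit `p * (a - b p + c pbar)`. -/
theorem Market.Admissible.profit_lt {M : Market} (hM : M.Admissible) {pbar p : ℝ}
    (hp : p ≠ M.BR pbar) :
    p * (M.a - M.b * p + M.c * pbar)
      < M.BR pbar * (M.a - M.b * M.BR pbar + M.c * pbar) := by
  have hb : 0 < M.b := hM.c_pos.trans hM.c_lt_b
  have h : M.a + M.c * pbar = 2 * M.b * M.BR pbar := by
    unfold Market.BR; field_simp
  have h2 : 0 < M.b * (p - M.BR pbar) ^ 2 :=
    mul_pos hb (by have := sub_ne_zero.mpr hp; positivity)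
  have e : ∀ q : ℝ, M.a - M.b * q + M.c * pbar = 2 * M.b * M.BR pbar - M.b * q := by
    intro q; rw [← h]; ring
  rw [e, e]
  nlinarith

/-- The Nash price is the unique fixed point of the best response. -/
theorem Market.Admissible.BR_eq_self_iff {M : Market} (hM : M.Admissible) (p : ℝ) :
    M.BR p = p ↔ p = M.nash := by
  have hb : 0 < M.b := hM.c_pos.trans hM.c_lt_b
  have h1 : 0 < 2 * M.b - M.c := by linarith [hM.c_lt_b]
  unfold Market.BR Market.nash
  rw [div_eq_iff (by positivity), eq_div_iff h1.ne']
  constructor <;> intro h <;> linarith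

/-- The price box `[Pmin, Pmax]^N`. -/
def Market.priceBox (M : Market) (N : ℕ) : Set (Fin N → ℝ) :=
  {p | ∀ i, p i ∈ Set.Icc M.Pmin M.Pmax}

/-- The upper best-response cone `C⁺`. -/
def Market.upperCone (M : Market) (N : ℕ) : Set (Fin N → ℝ) :=
  {μ | μ ∈ M.priceBox N ∧ ∀ i, M.BR (othersAvg μ i) < μ i}

/-- The lower best-response cone `C⁻`. -/
def Market.lowerCone (M : Market) (N : ℕ) : Set (Fin N → ℝ) :=
  {μ | μ ∈ M.priceBox N ∧ ∀ i, μ i < M.BR (othersAvg μ i)}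

/-- The unconstrained price computed by firm `i` from the moments `(U, V)`. -/
def Market.rawPrice (M : Market) {N : ℕ} (U : Fin N → ℝ) (V : Matrix (Fin N) (Fin N) ℝ)
    (i : Fin N) : ℝ :=
  ((M.a + M.c * othersAvg U i) * V i i - M.c * U i * othersAvg (V i) i) /
    (2 * (M.b * V i i - M.c * othersAvg (V i) i))

/-- The posted price of firm `i` at the moments `(U, V)`: the raw price clipped to
`[Pmin, Pmax]` if the fitted slope is negative, and `Pmax` otherwise. -/
def Market.price (M : Market) {N : ℕ} (U : Fin N → ℝ) (V : Matrix (Fin N) (Fin N) ℝ)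
    (i : Fin N) : ℝ :=
  if -M.b * V i i + M.c * othersAvg (V i) i < 0 then
    max M.Pmin (min (M.rawPrice U V i) M.Pmax)
  else M.Pmax

/-- `(U, V)` solves the price-moments ODE on `[1, ∞)` with `U 1 = μ`, `V 1 = S`
(the derivative at `τ = 1` is one-sided; values at `τ < 1` are irrelevant). -/
structure Market.IsSolution (M : Market) {N : ℕ} (μ : Fin N → ℝ)
    (S : Matrix (Fin N) (Fin N) ℝ) (U : ℝ → Fin N → ℝ)
    (V : ℝ → Matrix (Fin N) (Fin N) ℝ) : Prop where
  init_U : U 1 = μ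
  init_V : V 1 = S
  deriv_U : ∀ τ : ℝ, 1 ≤ τ → ∀ i, HasDerivWithinAt (fun t => U t i)
    ((M.price (U τ) (V τ) i - U τ i) / τ) (Set.Ici 1) τ
  deriv_V : ∀ τ : ℝ, 1 ≤ τ → ∀ i j, HasDerivWithinAt (fun t => V t i j)
    ((M.price (U τ) (V τ) i - U τ i) * (M.price (U τ) (V τ) j - U τ j)) (Set.Ici 1) τ

end PriceMoments

end

/-!
Write `D = P - U` for the adjustments and `ρ i` for the regression coefficient of the competitors'
average price on firm `i`'s own price, read off from `V`. Firm `i` moves up or down according to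
the sign of its *pull* `a + c * ubar i - 2 * b * U i + c * U i * ρ i`. If all pulls have the same
sign, all adjustments have that sign, and the competitors' common motion keeps each pull from
reaching `0`. So the pulls keep their initial signs, and the entries of `V` stay nonnegative.

In case (a) all pulls are negative. Since `ρ ≥ 0`, prices stay above best responses, hence above the
Nash price, and so do the posted prices.

In case (b) the prices increase to limits, at which no pull can be positive, since otherwise `U`
would grow logarithmically. If the prices never all exceeded the Nash price, all limits would have
to be the Nash price, approached from below. The total shortfall `E` below the Nash price makes
`t * E ^ 2` decreasing, and comparison with a barrier `m * exp (K * (t * E ^ 2))` bounds every `ρ i`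
away from `0`. A positive regression coefficient leaves a positive pull at Nash prices, a
contradiction.
-/

namespace PriceMoments

open Set Filter Topology Metric

open scoped NNReal

section IntegralCurve

variable {E : Type*} [NormedAddCommGroup E] [ProperSpace E]

theorem exists_lipschitzOnWith_closedBall {F : E → E} (hF : LocallyLipschitz F) (x₀ : E) (R : ℝ) :
    ∃ K : ℝ≥0, LipschitzOnWith K F (closedBall x₀ R) :=
  hF.locallyLipschitzOn.exists_lipschitzOnWith_of_compact (isCompact_closedBall x₀ R)

variable [NormedSpace ℝ E]

theorem eqOn_Icc_of_integralCurve {F : E → E} (hF : LocallyLipschitz F) {x y : ℝ → E} {t₀ T : ℝ}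
    (hx : ∀ t ∈ Icc t₀ T, HasDerivWithinAt x (F (x t)) (Icc t₀ T) t)
    (hy : ∀ t ∈ Icc t₀ T, HasDerivWithinAt y (F (y t)) (Icc t₀ T) t)
    (h₀ : x t₀ = y t₀) : EqOn x y (Icc t₀ T) := by
  have hx_cont : ContinuousOn x (Icc t₀ T) := fun t ht => (hx t ht).continuousWithinAt
  have hy_cont : ContinuousOn y (Icc t₀ T) := fun t ht => (hy t ht).continuousWithinAt
  obtain ⟨R, hR⟩ := ((isCompact_Icc.image_of_continuousOn hx_cont).union
    (isCompact_Icc.image_of_continuousOn hy_cont)).isBounded.subset_closedBall 0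
  obtain ⟨K, hK⟩ := exists_lipschitzOnWith_closedBall hF 0 R
  exact ODE_solution_unique_of_mem_Icc_right (v := fun _ => F) (s := fun _ => closedBall 0 R)
    (fun _ _ => hK) hx_cont
    (fun t ht => (hx t (Ico_subset_Icc_self ht)).mono_of_mem_nhdsWithin
      (Icc_mem_nhdsGE_of_mem ht))
    (fun t ht => hR (Or.inl (mem_image_of_mem x (Ico_subset_Icc_self ht)))) hy_cont
    (fun t ht => (hy t (Ico_subset_Icc_self ht)).mono_of_mem_nhdsWithin
      (Icc_mem_nhdsGE_of_mem ht))
    (fun t ht => hR (Or.inr (mem_image_of_mem y (Ico_subset_Icc_self ht)))) h₀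

theorem exists_integralCurve_Icc {F : E → E} (hF : LocallyLipschitz F) {L : ℝ≥0}
    (hL : ∀ x, ‖F x‖ ≤ L) (x₀ : E) {t₀ T : ℝ} (hT : t₀ ≤ T) :
    ∃ x : ℝ → E, x t₀ = x₀ ∧ ∀ t ∈ Icc t₀ T, HasDerivWithinAt x (F (x t)) (Icc t₀ T) t := by
  set R : ℝ≥0 := L * ⟨T - t₀, sub_nonneg.mpr hT⟩
  obtain ⟨K, hK⟩ := exists_lipschitzOnWith_closedBall hF x₀ R
  have hPL : IsPicardLindelof (fun _ => F) (tmin := t₀) (tmax := T) ⟨t₀, left_mem_Icc.mpr hT⟩ x₀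
      R 0 L K := by
    refine IsPicardLindelof.of_time_independent (fun x _ => hL x) hK ?_
    have hR_coe : (R : ℝ) = L * (T - t₀) := NNReal.coe_mul _ _
    simp [hT, hR_coe]
  exact hPL.exists_eq_forall_mem_Icc_hasDerivWithinAt₀

theorem exists_integralCurve_Ici {F : E → E} (hF : LocallyLipschitz F) {L : ℝ≥0}
    (hL : ∀ x, ‖F x‖ ≤ L) (x₀ : E) (t₀ : ℝ) :
    ∃ x : ℝ → E, x t₀ = x₀ ∧ ∀ t, t₀ ≤ t → HasDerivWithinAt x (F (x t)) (Ici t₀) t := by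
  choose x hx₀ hx using fun n : ℕ =>
    exists_integralCurve_Icc hF hL x₀ (show t₀ ≤ t₀ + n by simp)
  have agree : ∀ m n : ℕ, m ≤ n → EqOn (x m) (x n) (Icc t₀ (t₀ + m)) := by
    intro m n hmn
    have hsub : Icc t₀ (t₀ + m) ⊆ Icc t₀ (t₀ + (n : ℝ)) := Icc_subset_Icc_right (by gcongr)
    exact eqOn_Icc_of_integralCurve hF (hx m) (fun t ht => (hx n t (hsub ht)).mono hsub)
      ((hx₀ m).trans (hx₀ n).symm)
  let y : ℝ → E := fun t => x ⌈t - t₀⌉₊ t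
  have hy : ∀ n : ℕ, EqOn y (x n) (Icc t₀ (t₀ + n)) := by
    intro n t ht
    have hceil : t - t₀ ≤ ⌈t - t₀⌉₊ := Nat.le_ceil _
    exact agree _ n (Nat.ceil_le.mpr (by linarith [ht.2])) ⟨ht.1, by linarith⟩
  refine ⟨y, by rw [hy 0 (by simp), hx₀], fun t ht => ?_⟩
  obtain ⟨n, hn⟩ := exists_nat_gt (t - t₀)
  have htn : t ∈ Icc t₀ (t₀ + n) := ⟨ht, by linarith⟩
  have hderiv := (hx n t htn).congr_of_mem (hy n) htn
  rw [← hy n htn] at hderiv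
  refine hderiv.mono_of_mem_nhdsWithin ?_
  rw [← Ici_inter_Iic]
  exact inter_mem self_mem_nhdsWithin (mem_nhdsWithin_of_mem_nhds (Iic_mem_nhds (by linarith)))

end IntegralCurve

section LocallyLipschitz

variable {X : Type*} [PseudoEMetricSpace X]

theorem locallyLipschitz_comp_of_contDiffAt {E F : Type*} [NormedAddCommGroup E] [NormedSpace ℝ E]
    [NormedAddCommGroup F] [NormedSpace ℝ F] {g : E → F} {f : X → E}
    (hg : ∀ x, ContDiffAt ℝ 1 g (f x)) (hf : LocallyLipschitz f) :
    LocallyLipschitz fun x => g (f x) := by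
  intro x
  obtain ⟨K, t, ht, hgK⟩ := (hg x).exists_lipschitzOnWith
  obtain ⟨L, s, hs, hfL⟩ := hf x
  refine ⟨K * L, s ∩ f ⁻¹' t, inter_mem hs (hf.continuous.continuousAt ht), ?_⟩
  exact hgK.comp (hfL.mono inter_subset_left) fun y hy => hy.2

theorem locallyLipschitz_pi {ι : Type*} [Fintype ι] {β : ι → Type*}
    [∀ i, PseudoEMetricSpace (β i)] {f : X → ∀ i, β i}
    (hf : ∀ i, LocallyLipschitz fun x => f x i) : LocallyLipschitz f := by
  intro x
  choose K t ht hK using fun i => hf i x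
  refine ⟨∑ i, K i, ⋂ i, t i, iInter_mem.mpr ht, fun y hy z hz => ?_⟩
  refine edist_pi_le_iff.mpr fun i => (hK i (mem_iInter.mp hy i) (mem_iInter.mp hz i)).trans ?_
  gcongr
  exact_mod_cast Finset.single_le_sum (f := K) (fun _ _ => zero_le) (Finset.mem_univ i)

end LocallyLipschitz

section RealAnalysis

theorem monotoneOn_Ici_of_hasDerivWithinAt_nonneg {f f' : ℝ → ℝ} {s : ℝ}
    (hf : ∀ t, s ≤ t → HasDerivWithinAt f (f' t) (Ici s) t) (hf' : ∀ t, s ≤ t → 0 ≤ f' t) :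
    MonotoneOn f (Ici s) :=
  monotoneOn_of_hasDerivWithinAt_nonneg (convex_Ici s) (fun t ht => (hf t ht).continuousWithinAt)
    (fun t ht => (hf t (interior_subset ht)).mono interior_subset)
    (fun t ht => hf' t (interior_subset ht))

theorem exists_tendsto_of_monotoneOn_Ici {f : ℝ → ℝ} {s B : ℝ} (hf : MonotoneOn f (Ici s))
    (hB : ∀ t, s ≤ t → f t ≤ B) :
    ∃ L, Tendsto f atTop (𝓝 L) ∧ ∀ t, s ≤ t → f t ≤ L := by
  have hmono : Monotone fun t => f (max t s) := fun a b hab =>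
    hf (mem_Ici.mpr (le_max_right a s)) (mem_Ici.mpr (le_max_right b s)) (max_le_max_right s hab)
  have hbdd : BddAbove (range fun t => f (max t s)) :=
    ⟨B, by rintro _ ⟨t, rfl⟩; exact hB _ (le_max_right _ _)⟩
  refine ⟨_, (tendsto_atTop_ciSup hmono hbdd).congr' ?_, fun t ht => ?_⟩
  · filter_upwards [eventually_ge_atTop s] with t ht
    rw [max_eq_left ht]
  · simpa only [max_eq_left ht] using le_ciSup hbdd t

theorem mem_Icc_mul_of_hasDerivWithinAt {w p : ℝ → ℝ} {m r s : ℝ}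
    (hw : ∀ t, s ≤ t → HasDerivWithinAt w (p t) (Ici s) t)
    (hp : ∀ t, s ≤ t → p t ∈ Icc m r) (hs : w s ∈ Icc (m * s) (r * s)) {τ : ℝ} (hτ : s ≤ τ) :
    w τ ∈ Icc (m * τ) (r * τ) := by
  have hid : ∀ t : ℝ, HasDerivWithinAt (fun t : ℝ => t) 1 (Ici s) t := fun t =>
    hasDerivWithinAt_id t _
  have hlower := monotoneOn_Ici_of_hasDerivWithinAt_nonneg (f := fun t => w t - m * t)
    (fun t ht => (hw t ht).sub ((hid t).const_mul m))
    (fun t ht => by linarith [(hp t ht).1]) self_mem_Ici hτ hτ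
  have hupper := monotoneOn_Ici_of_hasDerivWithinAt_nonneg (f := fun t => r * t - w t)
    (fun t ht => ((hid t).const_mul r).sub (hw t ht))
    (fun t ht => by linarith [(hp t ht).2]) self_mem_Ici hτ hτ
  simp only at hlower hupper
  constructor <;> linarith [hs.1, hs.2]

theorem tendsto_atTop_of_const_le_mul_deriv {f f' : ℝ → ℝ} {s δ : ℝ} (hs : 0 < s) (hδ : 0 < δ)
    (hf : ∀ t, s ≤ t → HasDerivWithinAt f (f' t) (Ici s) t)
    (hf' : ∀ t, s ≤ t → δ ≤ t * f' t) : Tendsto f atTop atTop := by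
  have hmono : MonotoneOn (fun t => f t - δ * Real.log t) (Ici s) := by
    refine monotoneOn_Ici_of_hasDerivWithinAt_nonneg (f' := fun t => f' t - δ * t⁻¹)
      (fun t ht => (hf t ht).sub
        ((Real.hasDerivAt_log (hs.trans_le ht).ne').hasDerivWithinAt.const_mul δ)) fun t ht => ?_
    rw [sub_nonneg, ← div_eq_mul_inv, div_le_iff₀' (hs.trans_le ht)]
    exact hf' t ht
  have hlog : Tendsto (fun t => f s - δ * Real.log s + δ * Real.log t) atTop atTop :=
    tendsto_atTop_add_const_left _ _ (Real.tendsto_log_atTop.const_mul_atTop hδ)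
  refine tendsto_atTop_mono' _ ?_ hlog
  filter_upwards [eventually_ge_atTop s] with t ht
  have := hmono self_mem_Ici ht ht
  simp only at this
  linarith

variable {ι : Type*} [Finite ι]

theorem forall_pos_of_no_first_zero {f : ι → ℝ → ℝ} {s : ℝ}
    (hf : ∀ i, ContinuousOn (f i) (Ici s)) (hs : ∀ i, 0 < f i s)
    (hzero : ∀ T, s < T → (∀ t ∈ Ico s T, ∀ i, 0 < f i t) → (∀ i, 0 ≤ f i T) → ∀ i, f i T ≠ 0) :
    ∀ t, s ≤ t → ∀ i, 0 < f i t := by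
  by_contra! hcon
  obtain ⟨t₁, ht₁, i₁, hi₁⟩ := hcon
  set B : Set ℝ := ⋃ i, {t ∈ Ici s | f i t ∈ Iic 0}
  have hB_closed : IsClosed B := isClosed_iUnion_of_finite fun i =>
    (hf i).preimage_isClosed_of_isClosed isClosed_Ici isClosed_Iic
  have hB_bdd : BddBelow B := ⟨s, fun t ht => (mem_iUnion.mp ht).elim fun _ h => h.1⟩
  have hT_mem : sInf B ∈ B := hB_closed.csInf_mem ⟨t₁, mem_iUnion.mpr ⟨i₁, ht₁, hi₁⟩⟩ hB_bdd
  set T := sInf B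
  obtain ⟨i, hsT : s ≤ T, hiT : f i T ≤ 0⟩ := mem_iUnion.mp hT_mem
  have hlt : s < T := hsT.lt_of_ne fun h => (hs i).not_ge (h ▸ hiT)
  have hbefore : ∀ t ∈ Ico s T, ∀ j, 0 < f j t := by
    intro t ht j
    by_contra! hj
    exact (csInf_le hB_bdd (mem_iUnion.mpr ⟨j, ht.1, hj⟩)).not_gt ht.2
  have hT_nonneg : ∀ j, 0 ≤ f j T := by
    intro j
    have hcont : Tendsto (f j) (𝓝[<] T) (𝓝 (f j T)) :=
      nhdsWithin_Ico_eq_nhdsLT hlt ▸ (hf j T hsT).mono Ico_subset_Ici_self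
    refine ge_of_tendsto hcont ?_
    filter_upwards [Ico_mem_nhdsLT hlt] with t ht using (hbefore t ht j).le
  exact hzero T hlt hbefore hT_nonneg i (le_antisymm hiT (hT_nonneg i))

theorem forall_pos_of_deriv_pos_of_eq_zero {f f' : ι → ℝ → ℝ} {s : ℝ}
    (hf : ∀ i t, s ≤ t → HasDerivWithinAt (f i) (f' i t) (Ici s) t) (hs : ∀ i, 0 < f i s)
    (hf' : ∀ t, s ≤ t → (∀ j, 0 ≤ f j t) → ∀ i, f i t = 0 → 0 < f' i t) :
    ∀ t, s ≤ t → ∀ i, 0 < f i t := by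
  refine forall_pos_of_no_first_zero (fun i t ht => (hf i t ht).continuousWithinAt) hs
    fun T hsT hbefore hT i hiT => ?_
  have hslope : Tendsto (slope (f i) T) (𝓝[<] T) (𝓝 (f' i T)) :=
    nhdsWithin_Ico_eq_nhdsLT hsT ▸ (hasDerivWithinAt_iff_tendsto_slope.mp (hf i T hsT.le)).mono_left
      (nhdsWithin_mono _ fun t ht => ⟨ht.1, ht.2.ne⟩)
  refine (hf' T hsT.le hT i hiT).not_ge (le_of_tendsto hslope ?_)
  filter_upwards [Ico_mem_nhdsLT hsT] with t ht
  rw [slope_def_field, hiT, sub_zero]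
  exact div_nonpos_of_nonneg_of_nonpos (hbefore t ht i).le (by linarith [ht.2])

theorem pos_of_neg_mul_le_deriv {f f' : ℝ → ℝ} {s T C : ℝ} (hsT : s < T) (hs : 0 < f s)
    (hf : ∀ t ∈ Icc s T, HasDerivWithinAt f (f' t) (Icc s T) t)
    (hf' : ∀ t ∈ Ioo s T, -C * f t ≤ f' t) : 0 < f T := by
  have hderiv : ∀ t ∈ Icc s T, HasDerivWithinAt (fun t => f t * Real.exp (C * t))
      (f' t * Real.exp (C * t) + f t * (Real.exp (C * t) * C)) (Icc s T) t := fun t ht => by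
    have hlin : HasDerivWithinAt (fun t : ℝ => C * t) C (Icc s T) t := by
      simpa using (hasDerivWithinAt_id t (Icc s T)).const_mul C
    exact (hf t ht).mul hlin.exp
  have hmono : MonotoneOn (fun t => f t * Real.exp (C * t)) (Icc s T) := by
    refine monotoneOn_of_hasDerivWithinAt_nonneg (convex_Icc s T)
      (fun t ht => (hderiv t ht).continuousWithinAt)
      (fun t ht => (hderiv t (interior_subset ht)).mono interior_subset) fun t ht => ?_
    rw [interior_Icc] at ht
    linarith [mul_nonneg (sub_nonneg.mpr (hf' t ht)) (Real.exp_pos (C * t)).le]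
  have hle := hmono (left_mem_Icc.mpr hsT.le) (right_mem_Icc.mpr hsT.le) hsT.le
  exact pos_of_mul_pos_left ((mul_pos hs (Real.exp_pos _)).trans_le hle) (Real.exp_pos _).le

theorem forall_pos_of_neg_mul_le_deriv {f f' : ι → ℝ → ℝ} {s : ℝ}
    (hf : ∀ i t, s ≤ t → HasDerivWithinAt (f i) (f' i t) (Ici s) t) (hs : ∀ i, 0 < f i s)
    (hf' : ∀ i T, ∃ C, ∀ t ∈ Icc s T, (∀ j, 0 < f j t) → -C * f i t ≤ f' i t) :
    ∀ t, s ≤ t → ∀ i, 0 < f i t := by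
  refine forall_pos_of_no_first_zero (fun i t ht => (hf i t ht).continuousWithinAt) hs
    fun T hsT hbefore _ i => ?_
  obtain ⟨C, hC⟩ := hf' i T
  exact (pos_of_neg_mul_le_deriv hsT (hs i)
    (fun t ht => (hf i t ht.1).mono Icc_subset_Ici_self)
    (fun t ht => hC t (Ioo_subset_Icc_self ht) (hbefore t (Ioo_subset_Ico_self ht)))).ne'

/- At a first time when `ρ i` touches the barrier `m * exp φ` it is the smallest of the family,
and the hypothesis says that there it grows faster than the barrier. -/
theorem exists_pos_le_of_deriv_gt_at_min {ρ ρ' : ι → ℝ → ℝ} {φ φ' : ℝ → ℝ} {s r A B : ℝ}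
    (hρ : ∀ i t, s ≤ t → HasDerivWithinAt (ρ i) (ρ' i t) (Ici s) t)
    (hφ : ∀ t, s ≤ t → HasDerivWithinAt φ (φ' t) (Ici s) t)
    (hφ_mem : ∀ t, s ≤ t → φ t ∈ Icc A B) (hr : 0 < r) (hs : ∀ i, 0 < ρ i s)
    (hmin : ∀ t, s ≤ t → ∀ i, 0 < ρ i t → ρ i t ≤ r → (∀ j, ρ i t ≤ ρ j t) →
      φ' t * ρ i t < ρ' i t) :
    ∃ m, 0 < m ∧ ∀ t, s ≤ t → ∀ i, m ≤ ρ i t := by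
  have hsmall : ∀ x y : ℝ, 0 < y → ∀ᶠ m in 𝓝[>] (0 : ℝ), m * x < y := fun x y hy =>
    nhdsWithin_le_nhds
      (((continuous_mul_const x).tendsto' 0 0 (zero_mul x)).eventually_lt_const hy)
  obtain ⟨m, hm, hmr, hms⟩ : ∃ m : ℝ, 0 < m ∧ m * Real.exp B < r ∧
      ∀ i, m * Real.exp (φ s) < ρ i s :=
    (eventually_mem_nhdsWithin.and ((hsmall _ _ hr).and
      (eventually_all.mpr fun i => hsmall _ _ (hs i)))).exists
  have hbarrier := forall_pos_of_deriv_pos_of_eq_zero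
    (f := fun i t => ρ i t - m * Real.exp (φ t))
    (fun i t ht => (hρ i t ht).sub ((hφ t ht).exp.const_mul m)) (fun i => sub_pos.mpr (hms i))
    fun t ht hnonneg i hi => by
      have htouch : ρ i t = m * Real.exp (φ t) := sub_eq_zero.mp hi
      have hle_r : ρ i t ≤ r := by
        rw [htouch]
        exact (mul_le_mul_of_nonneg_left (Real.exp_le_exp.mpr (hφ_mem t ht).2) hm.le).trans hmr.le
      have := hmin t ht i (htouch ▸ by positivity) hle_r
        fun j => htouch.le.trans (sub_nonneg.mp (hnonneg j))
      rw [htouch] at this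
      linarith
  refine ⟨m * Real.exp A, by positivity, fun t ht i => ?_⟩
  exact (mul_le_mul_of_nonneg_left (Real.exp_le_exp.mpr (hφ_mem t ht).1) hm.le).trans
    (sub_pos.mp (hbarrier t ht i)).le

end RealAnalysis

section OthersAvg

variable {N : ℕ}

theorem othersAvg_mono {x y : Fin N → ℝ} {i : Fin N} (h : ∀ j, j ≠ i → x j ≤ y j) :
    othersAvg x i ≤ othersAvg y i := by
  have hN : (1 : ℝ) ≤ N := by exact_mod_cast i.pos
  exact div_le_div_of_nonneg_right
    (Finset.sum_le_sum fun j hj => h j (Finset.ne_of_mem_erase hj)) (sub_nonneg.mpr hN)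

theorem othersAvg_nonneg {x : Fin N → ℝ} {i : Fin N} (h : ∀ j, j ≠ i → 0 ≤ x j) :
    0 ≤ othersAvg x i := by
  simpa [othersAvg] using othersAvg_mono (x := fun _ => 0) h

theorem othersAvg_sub (x y : Fin N → ℝ) (i : Fin N) :
    othersAvg (fun j => x j - y j) i = othersAvg x i - othersAvg y i := by
  simp [othersAvg, Finset.sum_sub_distrib, sub_div]

theorem othersAvg_const_mul (r : ℝ) (x : Fin N → ℝ) (i : Fin N) :
    othersAvg (fun j => r * x j) i = r * othersAvg x i := by
  simp [othersAvg, ← Finset.mul_sum, mul_div_assoc]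

theorem othersAvg_div (x : Fin N → ℝ) (r : ℝ) (i : Fin N) :
    othersAvg (fun j => x j / r) i = othersAvg x i / r := by
  simp [othersAvg, ← Finset.sum_div, div_right_comm]

theorem contDiff_othersAvg {n : WithTop ℕ∞} (i : Fin N) :
    ContDiff ℝ n fun x : Fin N → ℝ => othersAvg x i := by
  unfold othersAvg; fun_prop

theorem tendsto_othersAvg {X : Type*} {l : Filter X} {x : X → Fin N → ℝ} {y : Fin N → ℝ}
    (h : ∀ j, Tendsto (fun t => x t j) l (𝓝 (y j))) (i : Fin N) :
    Tendsto (fun t => othersAvg (x t) i) l (𝓝 (othersAvg y i)) :=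
  ((contDiff_othersAvg (n := 0) i).continuous.tendsto y).comp (tendsto_pi_nhds.mpr h)

theorem hasDerivWithinAt_othersAvg {x : ℝ → Fin N → ℝ} {x' : Fin N → ℝ} {s : Set ℝ} {t : ℝ}
    (h : ∀ j, HasDerivWithinAt (fun t => x t j) (x' j) s t) (i : Fin N) :
    HasDerivWithinAt (fun t => othersAvg (x t) i) (othersAvg x' i) s t :=
  (HasDerivWithinAt.fun_sum fun j _ => h j).div_const _

theorem othersAvg_const (hN : 2 ≤ N) (r : ℝ) (i : Fin N) : othersAvg (fun _ => r) i = r := by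
  have hN' : (N : ℝ) - 1 ≠ 0 := sub_ne_zero.mpr (by exact_mod_cast (by omega : N ≠ 1))
  simp only [othersAvg, Finset.sum_const, Finset.card_erase_of_mem (Finset.mem_univ i),
    Finset.card_univ, Fintype.card_fin, nsmul_eq_mul, Nat.cast_sub (by omega : 1 ≤ N), Nat.cast_one]
  field_simp

theorem le_othersAvg (hN : 2 ≤ N) {x : Fin N → ℝ} {i : Fin N} {r : ℝ}
    (h : ∀ j, j ≠ i → r ≤ x j) : r ≤ othersAvg x i :=
  (othersAvg_const hN r i).symm.le.trans (othersAvg_mono h)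

theorem othersAvg_le (hN : 2 ≤ N) {x : Fin N → ℝ} {i : Fin N} {r : ℝ}
    (h : ∀ j, j ≠ i → x j ≤ r) : othersAvg x i ≤ r :=
  (othersAvg_mono h).trans (othersAvg_const hN r i).le

theorem lt_othersAvg_of_le_of_lt (hN : 2 ≤ N) {x : Fin N → ℝ} {i j : Fin N} {r : ℝ}
    (h : ∀ k, k ≠ i → r ≤ x k) (hji : j ≠ i) (hj : r < x j) : r < othersAvg x i := by
  have hN' : (0 : ℝ) < N - 1 := sub_pos.mpr (by exact_mod_cast (by omega : 1 < N))
  rw [← othersAvg_const hN r i]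
  exact div_lt_div_of_pos_right
    (Finset.sum_lt_sum (fun k hk => h k (Finset.ne_of_mem_erase hk))
      ⟨j, Finset.mem_erase.mpr ⟨hji, Finset.mem_univ j⟩, hj⟩) hN'

theorem lt_othersAvg (hN : 2 ≤ N) {x : Fin N → ℝ} {i : Fin N} {r : ℝ}
    (h : ∀ j, j ≠ i → r < x j) : r < othersAvg x i := by
  have : Nontrivial (Fin N) := Fin.nontrivial_iff_two_le.mpr hN
  obtain ⟨j, hj⟩ := exists_ne i
  exact lt_othersAvg_of_le_of_lt hN (fun k hk => (h k hk).le) hj (h j hj)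

theorem sum_othersAvg (hN : 2 ≤ N) (x : Fin N → ℝ) : ∑ i, othersAvg x i = ∑ i, x i := by
  have hN' : (N : ℝ) - 1 ≠ 0 := sub_ne_zero.mpr (by exact_mod_cast (by omega : N ≠ 1))
  unfold othersAvg
  rw [← Finset.sum_div, div_eq_iff hN']
  simp only [Finset.sum_erase_eq_sub (Finset.mem_univ _), Finset.sum_sub_distrib,
    Finset.sum_const, Finset.card_univ, Fintype.card_fin, nsmul_eq_mul]
  ring

theorem othersAvg_le_sum (hN : 2 ≤ N) {x : Fin N → ℝ} (hx : ∀ j, 0 ≤ x j) (i : Fin N) :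
    othersAvg x i ≤ ∑ j, x j :=
  othersAvg_le hN fun j _ => Finset.single_le_sum (fun k _ => hx k) (Finset.mem_univ j)

end OthersAvg

namespace Market

section Admissible

variable {M : Market}

theorem Admissible.b_pos (hM : M.Admissible) : 0 < M.b := hM.c_pos.trans hM.c_lt_b

theorem Admissible.nash_mul (hM : M.Admissible) : (2 * M.b - M.c) * M.nash = M.a :=
  mul_div_cancel₀ _ (by linarith [hM.c_lt_b, hM.c_pos])

theorem Admissible.b_mul_Pmax_le (hM : M.Admissible) : M.b * M.Pmax ≤ M.a :=
  (le_div_iff₀' hM.b_pos).mp hM.Pmax_le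

theorem Admissible.Pmin_lt_Pmax (hM : M.Admissible) : M.Pmin < M.Pmax :=
  hM.Pmin_le_nash.trans_lt hM.nash_lt_Pmax

theorem Admissible.Pmax_pos (hM : M.Admissible) : 0 < M.Pmax :=
  hM.Pmin_pos.trans hM.Pmin_lt_Pmax

theorem Admissible.nash_pos (hM : M.Admissible) : 0 < M.nash :=
  hM.Pmin_pos.trans_le hM.Pmin_le_nash

theorem Admissible.Pmax_lt_two_mul_nash (hM : M.Admissible) : M.Pmax < 2 * M.nash := by
  have hcn := mul_pos hM.c_pos hM.nash_pos
  refine lt_of_mul_lt_mul_left ?_ hM.b_pos.le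
  linarith [hM.nash_mul, hM.b_mul_Pmax_le]

end Admissible

/-- Projection onto the price interval `[Pmin, Pmax]`. -/
noncomputable def clip (M : Market) (x : ℝ) : ℝ := max M.Pmin (min x M.Pmax)

/-- The force on a firm with average price `u`, competitors' average price `ubar` and regression
coefficient `ρ` (see `regCoeff`): `2 * (b - c * ρ)` times the move from `u` to the raw price. At
`ρ = 0` its sign compares `u` with the best response to `ubar`. -/
noncomputable def pull (M : Market) (u ubar ρ : ℝ) : ℝ :=
  M.a + M.c * ubar - 2 * M.b * u + M.c * u * ρ

/-- The posted price as a function of a firm's average price `u`, its competitors' average price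
`ubar` and its regression coefficient `ρ` (see `regCoeff`); the fitted slope is `c * ρ - b`. -/
noncomputable def postedPrice (M : Market) (u ubar ρ : ℝ) : ℝ :=
  if 0 < M.b - M.c * ρ then M.clip (u + M.pull u ubar ρ / (2 * (M.b - M.c * ρ))) else M.Pmax

/-- The value of `b - c * ρ` up to which the posted price is `Pmax`, whatever the price averages
(see `Admissible.postedPrice_eq_regPrice`). -/
noncomputable def minSlope (M : Market) : ℝ := M.c * M.Pmin / (2 * M.Pmax)

/-- The posted price with `b - c * ρ` cut off below at `minSlope`. It agrees with `postedPrice` on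
the price interval but is locally Lipschitz everywhere. -/
noncomputable def regPrice (M : Market) (u ubar ρ : ℝ) : ℝ :=
  M.clip (u / 2 + (M.a + M.c * ubar - M.b * u) / (2 * max (M.b - M.c * ρ) M.minSlope))

section ScalarPrice

variable {M : Market} {u ubar ρ : ℝ}

theorem Admissible.minSlope_pos (hM : M.Admissible) : 0 < M.minSlope :=
  div_pos (mul_pos hM.c_pos hM.Pmin_pos) (mul_pos two_pos hM.Pmax_pos)

theorem Admissible.Pmax_mul_minSlope (hM : M.Admissible) :
    M.Pmax * M.minSlope = M.c * M.Pmin / 2 := by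
  have := hM.Pmax_pos.ne'
  unfold minSlope
  field_simp

theorem clip_of_mem {x : ℝ} (hx : x ∈ Icc M.Pmin M.Pmax) : M.clip x = x := by
  rw [clip, min_eq_left hx.2, max_eq_right hx.1]

theorem Admissible.clip_mem (hM : M.Admissible) (x : ℝ) : M.clip x ∈ Icc M.Pmin M.Pmax :=
  ⟨le_max_left _ _, max_le hM.Pmin_lt_Pmax.le (min_le_right _ _)⟩

theorem Admissible.clip_of_Pmax_le (hM : M.Admissible) {x : ℝ} (hx : M.Pmax ≤ x) :
    M.clip x = M.Pmax := by
  rw [clip, min_eq_right hx, max_eq_right hM.Pmin_lt_Pmax.le]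

theorem min_le_clip_add_sub (u x : ℝ) : min x (M.Pmax - u) ≤ M.clip (u + x) - u := by
  rw [le_sub_iff_add_le, ← min_add_add_right, sub_add_cancel, add_comm x]
  exact le_max_right _ _

theorem clip_add_sub_mem (hu : u ∈ Icc M.Pmin M.Pmax) (x : ℝ) :
    M.clip (u + x) - u ∈ Icc (min 0 x) (max 0 x) := by
  refine ⟨?_, ?_⟩
  · exact (le_min (min_le_right 0 x)
      ((min_le_left 0 x).trans (sub_nonneg.mpr hu.2))).trans (min_le_clip_add_sub u x)
  · rw [sub_le_iff_le_add]
    refine max_le (hu.1.trans ?_) ((min_le_left _ _).trans ?_)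
    · linarith [le_max_left 0 x]
    · linarith [le_max_right 0 x]

theorem abs_clip_add_sub_le (hu : u ∈ Icc M.Pmin M.Pmax) (x : ℝ) :
    |M.clip (u + x) - u| ≤ |x| := by
  have h := clip_add_sub_mem hu x
  refine abs_le.mpr ⟨(le_min ?_ (neg_abs_le x)).trans h.1, h.2.trans (max_le ?_ (le_abs_self x))⟩
  · exact neg_nonpos.mpr (abs_nonneg x)
  · exact abs_nonneg x

theorem postedPrice_of_pos (h : 0 < M.b - M.c * ρ) (u ubar : ℝ) :
    M.postedPrice u ubar ρ = M.clip (u + M.pull u ubar ρ / (2 * (M.b - M.c * ρ))) :=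
  if_pos h

theorem postedPrice_of_nonpos (h : M.b - M.c * ρ ≤ 0) (u ubar : ℝ) :
    M.postedPrice u ubar ρ = M.Pmax :=
  if_neg h.not_gt

theorem pull_eq_sub (M : Market) (u ubar ρ : ℝ) :
    M.pull u ubar ρ = M.a + M.c * ubar - M.b * u - u * (M.b - M.c * ρ) := by
  unfold pull; ring

theorem Admissible.pull_mono (hM : M.Admissible) {ρ' : ℝ} (hu : 0 ≤ u) (hρ : ρ ≤ ρ') :
    M.pull u ubar ρ ≤ M.pull u ubar ρ' := by
  unfold pull
  linarith [mul_le_mul_of_nonneg_left hρ (mul_nonneg hM.c_pos.le hu)]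

theorem Admissible.postedPrice_mem (hM : M.Admissible) (u ubar ρ : ℝ) :
    M.postedPrice u ubar ρ ∈ Icc M.Pmin M.Pmax := by
  unfold postedPrice
  split_ifs
  exacts [hM.clip_mem _, right_mem_Icc.mpr hM.Pmin_lt_Pmax.le]

theorem Admissible.c_mul_Pmin_le (hM : M.Admissible) (hu : u ≤ M.Pmax) (hubar : M.Pmin ≤ ubar) :
    M.c * M.Pmin ≤ M.a + M.c * ubar - M.b * u := by
  linarith [mul_le_mul_of_nonneg_left hubar hM.c_pos.le, mul_le_mul_of_nonneg_left hu hM.b_pos.le,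
    hM.b_mul_Pmax_le]

theorem Admissible.c_mul_Pmin_div_two_le_pull (hM : M.Admissible) (hu : u ∈ Icc M.Pmin M.Pmax)
    (hubar : M.Pmin ≤ ubar) (hρ : M.b - M.c * ρ ≤ M.minSlope) :
    M.c * M.Pmin / 2 ≤ M.pull u ubar ρ := by
  have hu_slope : u * (M.b - M.c * ρ) ≤ M.Pmax * M.minSlope :=
    (mul_le_mul_of_nonneg_left hρ (hM.Pmin_pos.le.trans hu.1)).trans
      (mul_le_mul_of_nonneg_right hu.2 hM.minSlope_pos.le)
  rw [pull_eq_sub]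
  linarith [hM.c_mul_Pmin_le hu.2 hubar, hM.Pmax_mul_minSlope]

theorem Admissible.postedPrice_eq_regPrice (hM : M.Admissible) (hu : u ∈ Icc M.Pmin M.Pmax)
    (hubar : M.Pmin ≤ ubar) : M.postedPrice u ubar ρ = M.regPrice u ubar ρ := by
  set k := M.a + M.c * ubar - M.b * u
  set d := M.b - M.c * ρ
  have hsat : ∀ r, 0 < r → r ≤ M.minSlope → M.clip (u / 2 + k / (2 * r)) = M.Pmax := by
    intro r hr hr_le
    refine hM.clip_of_Pmax_le (le_add_of_nonneg_of_le
      (by linarith [hM.Pmin_pos, hu.1]) ((le_div_iff₀ (by positivity)).mpr ?_))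
    linarith [mul_le_mul_of_nonneg_left hr_le hM.Pmax_pos.le, hM.Pmax_mul_minSlope,
      hM.c_mul_Pmin_le hu.2 hubar]
  have hraw : 0 < d → M.postedPrice u ubar ρ = M.clip (u / 2 + k / (2 * d)) := by
    intro h
    have hsum : u + M.pull u ubar ρ / (2 * d) = u / 2 + k / (2 * d) := by
      rw [pull_eq_sub]
      field_simp
      ring
    rw [postedPrice_of_pos h, hsum]
  unfold regPrice
  rcases le_or_gt M.minSlope d with h | h
  · rw [max_eq_left h, hraw (hM.minSlope_pos.trans_le h)]
  rw [max_eq_right h.le, hsat _ hM.minSlope_pos le_rfl]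
  rcases le_or_gt d 0 with h₀ | h₀
  · exact postedPrice_of_nonpos h₀ u ubar
  · rw [hraw h₀, hsat d h₀ h.le]

theorem Admissible.locallyLipschitz_regPrice (hM : M.Admissible) :
    LocallyLipschitz fun x : ℝ × ℝ × ℝ => M.regPrice x.1 x.2.1 x.2.2 := by
  have hslope : LocallyLipschitz fun x : ℝ × ℝ × ℝ => max (M.b - M.c * x.2.2) M.minSlope :=
    (ContDiff.locallyLipschitz (𝕂 := ℝ) (by fun_prop)).max_const _
  refine (LocallyLipschitz.min_const ?_ _).const_max _
  refine locallyLipschitz_comp_of_contDiffAt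
    (g := fun y : (ℝ × ℝ × ℝ) × ℝ => y.1.1 / 2 + (M.a + M.c * y.1.2.1 - M.b * y.1.1) / (2 * y.2))
    (fun x => ?_) (LocallyLipschitz.id.prodMk hslope)
  have hne : 2 * max (M.b - M.c * x.2.2) M.minSlope ≠ 0 :=
    (mul_pos two_pos (hM.minSlope_pos.trans_le (le_max_right _ _))).ne'
  fun_prop (disch := exact hne)

theorem Admissible.postedPrice_sub_mul_pull_nonneg (hM : M.Admissible)
    (hu : u ∈ Icc M.Pmin M.Pmax) (hubar : M.Pmin ≤ ubar) :
    0 ≤ (M.postedPrice u ubar ρ - u) * M.pull u ubar ρ := by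
  rcases le_or_gt (M.b - M.c * ρ) 0 with hd | hd
  · rw [postedPrice_of_nonpos hd]
    have := hM.c_mul_Pmin_div_two_le_pull hu hubar (hd.trans hM.minSlope_pos.le)
    exact mul_nonneg (sub_nonneg.mpr hu.2)
      ((half_pos (mul_pos hM.c_pos hM.Pmin_pos)).le.trans this)
  · rw [postedPrice_of_pos hd]
    have hmem := clip_add_sub_mem hu (M.pull u ubar ρ / (2 * (M.b - M.c * ρ)))
    rcases le_total 0 (M.pull u ubar ρ) with hp | hp
    · rw [min_eq_left (by positivity)] at hmem
      exact mul_nonneg hmem.1 hp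
    · rw [max_eq_left (div_nonpos_of_nonpos_of_nonneg hp (by positivity))] at hmem
      exact mul_nonneg_of_nonpos_of_nonpos hmem.2 hp

theorem Admissible.abs_postedPrice_sub_mul_le (hM : M.Admissible)
    (hu : u ∈ Icc M.Pmin M.Pmax) (hubar : M.Pmin ≤ ubar) :
    |M.postedPrice u ubar ρ - u| * M.minSlope ≤ |M.pull u ubar ρ| := by
  rcases le_or_gt (M.b - M.c * ρ) M.minSlope with hd | hd
  · have hle : |M.postedPrice u ubar ρ - u| ≤ M.Pmax := by
      have := hM.postedPrice_mem u ubar ρ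
      exact abs_le.mpr ⟨by linarith [this.1, hu.2, hM.Pmin_pos],
        by linarith [this.2, hu.1, hM.Pmin_pos]⟩
    calc |M.postedPrice u ubar ρ - u| * M.minSlope ≤ M.Pmax * M.minSlope :=
          mul_le_mul_of_nonneg_right hle hM.minSlope_pos.le
      _ = M.c * M.Pmin / 2 := hM.Pmax_mul_minSlope
      _ ≤ M.pull u ubar ρ := hM.c_mul_Pmin_div_two_le_pull hu hubar hd
      _ ≤ |M.pull u ubar ρ| := le_abs_self _
  · have hd₀ := hM.minSlope_pos.trans hd
    have hle := abs_clip_add_sub_le hu (M.pull u ubar ρ / (2 * (M.b - M.c * ρ)))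
    rw [abs_div, abs_of_pos (mul_pos two_pos hd₀), le_div_iff₀ (by positivity)] at hle
    rw [postedPrice_of_pos hd₀]
    refine le_trans (mul_le_mul_of_nonneg_left ?_ (abs_nonneg _)) hle
    linarith [hM.minSlope_pos]

theorem lt_postedPrice_of_pull_pos (hu : u < M.Pmax) (hp : 0 < M.pull u ubar ρ) :
    u < M.postedPrice u ubar ρ := by
  rcases le_or_gt (M.b - M.c * ρ) 0 with hd | hd
  · rwa [postedPrice_of_nonpos hd]
  · rw [postedPrice_of_pos hd, ← sub_pos]
    exact (lt_min (by positivity) (sub_pos.mpr hu)).trans_le (min_le_clip_add_sub _ _)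

theorem Admissible.min_le_postedPrice_sub (hM : M.Admissible) (hρ : 0 ≤ ρ)
    (hp : 0 ≤ M.pull u ubar ρ) :
    min (M.pull u ubar ρ / (2 * M.b)) (M.Pmax - u) ≤ M.postedPrice u ubar ρ - u := by
  rcases le_or_gt (M.b - M.c * ρ) 0 with hd | hd
  · rw [postedPrice_of_nonpos hd]
    exact min_le_right _ _
  · rw [postedPrice_of_pos hd]
    refine (min_le_min_right _ ?_).trans (min_le_clip_add_sub _ _)
    exact div_le_div_of_nonneg_left hp (by positivity)
      (by linarith [mul_nonneg hM.c_pos.le hρ])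

theorem Admissible.postedPrice_sub_le (hM : M.Admissible) (hu : u ∈ Icc M.Pmin M.Pmax)
    (hρ : M.c * ρ ≤ M.b / 2) (hp : 0 ≤ M.pull u ubar ρ) :
    M.postedPrice u ubar ρ - u ≤ M.pull u ubar ρ / M.b := by
  have hb := hM.b_pos
  have hd : M.b ≤ 2 * (M.b - M.c * ρ) := by linarith
  rw [postedPrice_of_pos (by linarith)]
  refine (clip_add_sub_mem hu _).2.trans (max_le (by positivity) ?_)
  exact div_le_div_of_nonneg_left hp hb hd

theorem Admissible.nash_lt_postedPrice (hM : M.Admissible) (hu : u ≤ M.Pmax)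
    (hubar : M.nash < ubar) (hρ : 0 ≤ ρ) : M.nash < M.postedPrice u ubar ρ := by
  rcases le_or_gt (M.b - M.c * ρ) 0 with hd | hd
  · rw [postedPrice_of_nonpos hd]
    exact hM.nash_lt_Pmax
  · rw [postedPrice_of_pos hd]
    refine lt_max_of_lt_right (lt_min ?_ hM.nash_lt_Pmax)
    rw [← sub_lt_iff_lt_add', lt_div_iff₀ (by positivity), pull]
    have hcρ : 0 ≤ M.c * ρ * (2 * M.nash - u) :=
      mul_nonneg (mul_nonneg hM.c_pos.le hρ) (by linarith [hM.Pmax_lt_two_mul_nash])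
    linarith [hM.nash_mul, mul_lt_mul_of_pos_left hubar hM.c_pos]

end ScalarPrice

end Market

/-- The regression coefficient of the competitors' average price on firm `i`'s own price in the
second-moment matrix `V`. -/
noncomputable def regCoeff {N : ℕ} (V : Matrix (Fin N) (Fin N) ℝ) (i : Fin N) : ℝ :=
  othersAvg (V i) i / V i i

namespace Market

/-- The price adjustment `P - U` that drives the price-moments system. -/
noncomputable def adj (M : Market) {N : ℕ} (U : Fin N → ℝ) (V : Matrix (Fin N) (Fin N) ℝ)
    (i : Fin N) : ℝ :=
  M.price U V i - U i

section VectorPrice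

variable {M : Market} {N : ℕ} {U : Fin N → ℝ} {V : Matrix (Fin N) (Fin N) ℝ} {i : Fin N}

theorem price_eq_postedPrice (hV : 0 < V i i) :
    M.price U V i = M.postedPrice (U i) (othersAvg U i) (regCoeff V i) := by
  have havg : othersAvg (V i) i = regCoeff V i * V i i := (div_mul_cancel₀ _ hV.ne').symm
  set ρ := regCoeff V i
  have hcond : -M.b * V i i + M.c * othersAvg (V i) i < 0 ↔ 0 < M.b - M.c * ρ := by
    rw [← mul_pos_iff_of_pos_right hV, havg]
    constructor <;> intro h <;> linarith
  unfold price postedPrice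
  refine ite_congr (propext hcond) (fun h => ?_) fun _ => rfl
  have hraw : M.rawPrice U V i = U i + M.pull (U i) (othersAvg U i) ρ / (2 * (M.b - M.c * ρ)) := by
    unfold rawPrice pull
    rw [havg]
    field_simp
    ring
  rw [hraw]; rfl

theorem Admissible.price_mem (hM : M.Admissible) (U : Fin N → ℝ)
    (V : Matrix (Fin N) (Fin N) ℝ) (i : Fin N) : M.price U V i ∈ Icc M.Pmin M.Pmax := by
  unfold price
  split_ifs
  exacts [hM.clip_mem _, right_mem_Icc.mpr hM.Pmin_lt_Pmax.le]

end VectorPrice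

end Market

/-- Phase space of the price-moments system in the coordinates `(τ, τ * U, V)`. There the system is
autonomous and bounded: the cumulative price `τ * U` has derivative the posted price. -/
abbrev State (N : ℕ) : Type := ℝ × (Fin N → ℝ) × (Fin N → Fin N → ℝ)

theorem State.hasDerivWithinAt_components {x : ℝ → State N} {x' : State N}
    {s : Set ℝ} {t : ℝ} (hx : HasDerivWithinAt x x' s t) :
    HasDerivWithinAt (fun t => (x t).1) x'.1 s t ∧
      (∀ i, HasDerivWithinAt (fun t => (x t).2.1 i) (x'.2.1 i) s t) ∧
      ∀ i j, HasDerivWithinAt (fun t => (x t).2.2 i j) (x'.2.2 i j) s t := by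
  have hsnd : HasDerivWithinAt (fun t => (x t).2) x'.2 s t :=
    (hasFDerivAt_snd.comp_hasDerivWithinAt t hx :)
  exact ⟨(hasFDerivAt_fst.comp_hasDerivWithinAt t hx :),
    hasDerivWithinAt_pi.mp (hasFDerivAt_fst.comp_hasDerivWithinAt t hsnd :),
    fun i => hasDerivWithinAt_pi.mp
      (hasDerivWithinAt_pi.mp (hasFDerivAt_snd.comp_hasDerivWithinAt t hsnd :) i)⟩

namespace Market

/-- The average price at a state. Clipping changes nothing along solutions and makes the field
below bounded. -/
noncomputable def stateMean (M : Market) {N : ℕ} (x : State N) (i : Fin N) : ℝ :=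
  M.clip (x.2.1 i / max x.1 1)

/-- The posted price at a state, where the own second moments are cut off below at `v > 0`. -/
noncomputable def statePrice (M : Market) {N : ℕ} (v : Fin N → ℝ) (x : State N) (i : Fin N) : ℝ :=
  M.regPrice (M.stateMean x i) (othersAvg (M.stateMean x) i)
    (othersAvg (x.2.2 i) i / max (x.2.2 i i) (v i))

/-- The price-moments vector field, regularized to be bounded and locally Lipschitz. -/
noncomputable def field (M : Market) {N : ℕ} (v : Fin N → ℝ) (x : State N) : State N :=
  (1, M.statePrice v x, fun i j =>
    (M.statePrice v x i - M.stateMean x i) * (M.statePrice v x j - M.stateMean x j))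

section Field

variable {M : Market} {N : ℕ} {v : Fin N → ℝ}

theorem othersAvg_mem_of_mem_priceBox (hN : 2 ≤ N) {U : Fin N → ℝ} (hU : U ∈ M.priceBox N)
    (i : Fin N) : othersAvg U i ∈ Icc M.Pmin M.Pmax :=
  ⟨le_othersAvg hN fun j _ => (hU j).1, othersAvg_le hN fun j _ => (hU j).2⟩

theorem locallyLipschitz_stateMean (M : Market) (i : Fin N) :
    LocallyLipschitz fun x => M.stateMean x i := by
  have htime : LocallyLipschitz fun x : State N => max x.1 1 :=
    LipschitzWith.prod_fst.locallyLipschitz.max_const _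
  refine (LocallyLipschitz.min_const ?_ _).const_max _
  refine locallyLipschitz_comp_of_contDiffAt (g := fun y : State N × ℝ => y.1.2.1 i / y.2)
    (fun x => ?_) (LocallyLipschitz.id.prodMk htime)
  have hne : max x.1 1 ≠ 0 := (one_pos.trans_le (le_max_right _ _)).ne'
  fun_prop (disch := exact hne)

theorem Admissible.locallyLipschitz_statePrice (hM : M.Admissible) {i : Fin N} (hv : 0 < v i) :
    LocallyLipschitz fun x => M.statePrice v x i := by
  have hmean := M.locallyLipschitz_stateMean (N := N)
  have havg : LocallyLipschitz fun x => othersAvg (M.stateMean x) i :=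
    locallyLipschitz_comp_of_contDiffAt (g := fun y : Fin N → ℝ => othersAvg y i)
      (fun _ => (contDiff_othersAvg i).contDiffAt) (locallyLipschitz_pi hmean)
  have hvar : LocallyLipschitz fun x : State N => max (x.2.2 i i) (v i) :=
    (ContDiff.locallyLipschitz (𝕂 := ℝ) (f := fun x : State N => x.2.2 i i)
      (by fun_prop)).max_const _
  have hcoeff : LocallyLipschitz fun x : State N =>
      othersAvg (x.2.2 i) i / max (x.2.2 i i) (v i) := by
    have hrow : LocallyLipschitz fun x : State N => x.2.2 i :=
      ContDiff.locallyLipschitz (𝕂 := ℝ) (by fun_prop)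
    have hg : ∀ x : State N, ContDiffAt ℝ 1 (fun y : (Fin N → ℝ) × ℝ => othersAvg y.1 i / y.2)
        (x.2.2 i, max (x.2.2 i i) (v i)) := by
      intro x
      have hne : max (x.2.2 i i) (v i) ≠ 0 := (hv.trans_le (le_max_right _ _)).ne'
      exact ((contDiff_othersAvg i).contDiffAt.comp _ contDiffAt_fst).fun_div contDiffAt_snd hne
    simpa only using locallyLipschitz_comp_of_contDiffAt hg (hrow.prodMk hvar)
  exact hM.locallyLipschitz_regPrice.comp ((hmean i).prodMk (havg.prodMk hcoeff))

theorem Admissible.locallyLipschitz_field (hM : M.Admissible) (hv : ∀ i, 0 < v i) :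
    LocallyLipschitz (M.field v) := by
  have hadj : ∀ i, LocallyLipschitz fun x => M.statePrice v x i - M.stateMean x i := fun i =>
    (hM.locallyLipschitz_statePrice (hv i)).sub (M.locallyLipschitz_stateMean i)
  refine (LocallyLipschitz.const 1).prodMk ((locallyLipschitz_pi fun i =>
    hM.locallyLipschitz_statePrice (hv i)).prodMk
    (locallyLipschitz_pi fun i => locallyLipschitz_pi fun j => ?_))
  exact locallyLipschitz_comp_of_contDiffAt (g := fun p : ℝ × ℝ => p.1 * p.2)
    (fun _ => by fun_prop) ((hadj i).prodMk (hadj j))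

theorem Admissible.norm_field_le (hM : M.Admissible) (x : State N) :
    ‖M.field v x‖ ≤ 1 + M.Pmax + M.Pmax ^ 2 := by
  have hPmin := hM.Pmin_pos
  have hPmax := hM.Pmax_pos
  have hprice : ∀ i, M.statePrice v x i ∈ Icc M.Pmin M.Pmax := fun i => hM.clip_mem _
  have hadj : ∀ i, |M.statePrice v x i - M.stateMean x i| ≤ M.Pmax := fun i => by
    have hmean : M.stateMean x i ∈ Icc M.Pmin M.Pmax := hM.clip_mem _
    exact abs_le.mpr ⟨by linarith [(hprice i).1, hmean.2], by linarith [(hprice i).2, hmean.1]⟩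
  refine norm_prod_le_iff.mpr ⟨?_, norm_prod_le_iff.mpr ⟨?_, ?_⟩⟩
  · simp only [field, norm_one]
    linarith [sq_nonneg M.Pmax]
  · refine (pi_norm_le_iff_of_nonneg (by positivity)).mpr fun i => ?_
    refine (abs_of_nonneg (hPmin.le.trans (hprice i).1)).le.trans ?_
    linarith [(hprice i).2, sq_nonneg M.Pmax]
  · refine (pi_norm_le_iff_of_nonneg (by positivity)).mpr fun i =>
      (pi_norm_le_iff_of_nonneg (by positivity)).mpr fun j => ?_
    simp only [field, Real.norm_eq_abs, abs_mul]
    linarith [mul_le_mul (hadj i) (hadj j) (abs_nonneg _) hPmax.le]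

theorem Admissible.field_apply (hM : M.Admissible) (hN : 2 ≤ N) {t : ℝ} {U : Fin N → ℝ}
    {V : Matrix (Fin N) (Fin N) ℝ} (ht : 1 ≤ t) (hU : U ∈ M.priceBox N) (hv : ∀ i, 0 < v i)
    (hV : ∀ i, v i ≤ V i i) :
    M.field v (t, fun i => t * U i, V) =
      (1, M.price U V, fun i j => M.adj U V i * M.adj U V j) := by
  have ht₀ : t ≠ 0 := (one_pos.trans_le ht).ne'
  have hmean : M.stateMean (t, fun i => t * U i, V) = U := by
    funext i
    simp only [stateMean, max_eq_left ht, mul_div_cancel_left₀ _ ht₀]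
    exact clip_of_mem (hU i)
  have hprice : M.statePrice v (t, fun i => t * U i, V) = M.price U V := by
    funext i
    rw [price_eq_postedPrice ((hv i).trans_le (hV i)),
      hM.postedPrice_eq_regPrice (hU i) (othersAvg_mem_of_mem_priceBox hN hU i).1]
    simp only [statePrice, hmean, max_eq_left (hV i), regCoeff]
  simp only [field, hmean, hprice, adj]

end Field

section Solution

variable {M : Market} {N : ℕ} {μ : Fin N → ℝ} {S : Matrix (Fin N) (Fin N) ℝ}
  {U : ℝ → Fin N → ℝ} {V : ℝ → Matrix (Fin N) (Fin N) ℝ}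

theorem IsSolution.hasDerivWithinAt_mul_U (h : M.IsSolution μ S U V) {τ : ℝ} (hτ : 1 ≤ τ)
    (i : Fin N) :
    HasDerivWithinAt (fun t => t * U t i) (M.price (U τ) (V τ) i) (Ici 1) τ := by
  have hτ₀ : τ ≠ 0 := (one_pos.trans_le hτ).ne'
  refine ((hasDerivWithinAt_id τ (Ici 1)).fun_mul (h.deriv_U τ hτ i)).congr_deriv ?_
  rw [id, mul_div_cancel₀ _ hτ₀]
  ring

theorem IsSolution.U_mem (hM : M.Admissible) (hμ : μ ∈ M.priceBox N)
    (h : M.IsSolution μ S U V) {τ : ℝ} (hτ : 1 ≤ τ) : U τ ∈ M.priceBox N := by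
  intro i
  have hτ₀ : 0 < τ := one_pos.trans_le hτ
  have hmem := mem_Icc_mul_of_hasDerivWithinAt (fun t ht => h.hasDerivWithinAt_mul_U ht i)
    (fun t _ => hM.price_mem (U t) (V t) i) (by simpa [h.init_U] using hμ i) hτ
  rw [mul_comm τ] at hmem
  exact ⟨le_of_mul_le_mul_right hmem.1 hτ₀, le_of_mul_le_mul_right hmem.2 hτ₀⟩

theorem IsSolution.le_V_diag (h : M.IsSolution μ S U V) {τ : ℝ} (hτ : 1 ≤ τ) (i : Fin N) :
    S i i ≤ V τ i i := by
  have := monotoneOn_Ici_of_hasDerivWithinAt_nonneg (fun t ht => h.deriv_V t ht i i)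
    (fun t _ => mul_self_nonneg _) self_mem_Ici hτ hτ
  simpa [h.init_V] using this

theorem IsSolution.hasDerivWithinAt_field (hM : M.Admissible) (hN : 2 ≤ N)
    (hμ : μ ∈ M.priceBox N) (hS : ∀ i, 0 < S i i) (h : M.IsSolution μ S U V) {τ : ℝ}
    (hτ : 1 ≤ τ) :
    HasDerivWithinAt (fun t => ((t, fun i => t * U t i, V t) : State N))
      (M.field (fun i => S i i) (τ, fun i => τ * U τ i, V τ)) (Ici 1) τ := by
  rw [hM.field_apply hN hτ (h.U_mem hM hμ hτ) hS (h.le_V_diag hτ)]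
  exact (hasDerivWithinAt_id τ _).prodMk
    ((hasDerivWithinAt_pi.mpr fun i => h.hasDerivWithinAt_mul_U hτ i).prodMk
      (hasDerivWithinAt_pi.mpr fun i => hasDerivWithinAt_pi.mpr fun j => h.deriv_V τ hτ i j))

theorem IsSolution.unique (hM : M.Admissible) (hN : 2 ≤ N) (hμ : μ ∈ M.priceBox N)
    (hS : ∀ i, 0 < S i i) (h : M.IsSolution μ S U V) {U' : ℝ → Fin N → ℝ}
    {V' : ℝ → Matrix (Fin N) (Fin N) ℝ} (h' : M.IsSolution μ S U' V') {τ : ℝ} (hτ : 1 ≤ τ) :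
    U' τ = U τ ∧ V' τ = V τ := by
  have hstate := eqOn_Icc_of_integralCurve (hM.locallyLipschitz_field hS) (t₀ := 1) (T := τ)
    (fun t ht => (h'.hasDerivWithinAt_field hM hN hμ hS ht.1).mono Icc_subset_Ici_self)
    (fun t ht => (h.hasDerivWithinAt_field hM hN hμ hS ht.1).mono Icc_subset_Ici_self)
    (by simp [h.init_U, h.init_V, h'.init_U, h'.init_V]) (right_mem_Icc.mpr hτ)
  obtain ⟨hU, hV⟩ := Prod.ext_iff.mp (Prod.ext_iff.mp hstate).2
  exact ⟨funext fun i => mul_left_cancel₀ (one_pos.trans_le hτ).ne' (congrFun hU i), hV⟩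

theorem Admissible.isSolution_of_integralCurve (hM : M.Admissible) (hN : 2 ≤ N)
    (hμ : μ ∈ M.priceBox N) (hS : ∀ i, 0 < S i i) {x : ℝ → State N} (hx₁ : x 1 = (1, μ, S))
    (hx : ∀ t, 1 ≤ t → HasDerivWithinAt x (M.field (fun i => S i i) (x t)) (Ici 1) t) :
    M.IsSolution μ S (fun t i => (x t).2.1 i / t) (fun t => (x t).2.2) := by
  choose htime' hW' hV' using fun t ht => State.hasDerivWithinAt_components (hx t ht)
  have htime : ∀ t, 1 ≤ t → (x t).1 = t := fun t ht => by
    have := mem_Icc_mul_of_hasDerivWithinAt htime' (m := 1) (r := 1)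
      (by simp [field]) (by simp [hx₁]) ht
    simpa using le_antisymm this.2 this.1
  have hbox : ∀ t, 1 ≤ t → (fun i => (x t).2.1 i / t) ∈ M.priceBox N := fun t ht i => by
    have hW := mem_Icc_mul_of_hasDerivWithinAt (fun t ht => hW' t ht i)
      (fun t _ => hM.clip_mem _) (by simpa [hx₁] using hμ i) ht
    have ht₀ : 0 < t := one_pos.trans_le ht
    exact ⟨(le_div_iff₀ ht₀).mpr hW.1, (div_le_iff₀ ht₀).mpr hW.2⟩
  have hV : ∀ t, 1 ≤ t → ∀ i, S i i ≤ (x t).2.2 i i := fun t ht i => by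
    simpa [hx₁] using monotoneOn_Ici_of_hasDerivWithinAt_nonneg (fun t ht => hV' t ht i i)
      (fun t _ => mul_self_nonneg _) self_mem_Ici ht ht
  have hx_eq : ∀ t, 1 ≤ t → (t, fun i => t * ((x t).2.1 i / t), (x t).2.2) = x t := fun t ht => by
    simp only [mul_div_cancel₀ _ (one_pos.trans_le ht).ne']
    exact Prod.ext (htime t ht).symm rfl
  have hfield : ∀ t, 1 ≤ t → M.field (fun i => S i i) (x t) = _ := fun t ht => by
    simpa only [hx_eq t ht] using hM.field_apply hN ht (hbox t ht) hS (hV t ht)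
  refine ⟨by simp [hx₁], by simp [hx₁], fun t ht i => ?_, fun t ht i j => ?_⟩
  · have ht₀ : t ≠ 0 := (one_pos.trans_le ht).ne'
    have hprice : (M.field (fun i => S i i) (x t)).2.1 i =
        M.price (fun i => (x t).2.1 i / t) (x t).2.2 i :=
      congrFun (congrArg (fun y : State N => y.2.1) (hfield t ht)) i
    refine ((hW' t ht i).fun_div (hasDerivWithinAt_id t _) ht₀).congr_deriv ?_
    rw [hprice, id]
    field_simp
  · have hadj := congrFun (congrFun (congrArg (fun y : State N => y.2.2) (hfield t ht)) i) j
    exact (hV' t ht i j).congr_deriv hadj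

theorem Admissible.exists_isSolution (hM : M.Admissible) (hN : 2 ≤ N) (hμ : μ ∈ M.priceBox N)
    (hS : ∀ i, 0 < S i i) : ∃ U V, M.IsSolution μ S U V := by
  have hL : 0 ≤ 1 + M.Pmax + M.Pmax ^ 2 := by linarith [hM.Pmax_pos, sq_nonneg M.Pmax]
  obtain ⟨x, hx₁, hx⟩ := exists_integralCurve_Ici (hM.locallyLipschitz_field hS) (L := ⟨_, hL⟩)
    hM.norm_field_le (1, μ, S) 1
  exact ⟨_, _, hM.isSolution_of_integralCurve hN hμ hS hx₁ hx⟩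

theorem IsSolution.continuousOn_adj (hM : M.Admissible) (hN : 2 ≤ N) (hμ : μ ∈ M.priceBox N)
    (hS : ∀ i, 0 < S i i) (h : M.IsSolution μ S U V) (i : Fin N) :
    ContinuousOn (fun t => M.adj (U t) (V t) i) (Ici 1) := by
  have hfield : ContinuousOn
      (fun t => M.field (fun i => S i i) ((t, fun i => t * U t i, V t) : State N)) (Ici 1) :=
    (hM.locallyLipschitz_field hS).continuous.comp_continuousOn fun t ht =>
      (h.hasDerivWithinAt_field hM hN hμ hS ht).continuousWithinAt
  have hprice : ContinuousOn (fun t => M.price (U t) (V t) i) (Ici 1) :=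
    (((continuous_apply i).comp (continuous_fst.comp continuous_snd)).comp_continuousOn
      hfield).congr fun t ht => by
        simp only [Function.comp_apply,
          hM.field_apply hN ht (h.U_mem hM hμ ht) hS (h.le_V_diag ht)]
  exact hprice.sub fun t ht => (h.deriv_U t ht i).continuousWithinAt

end Solution

/-- The pull on firm `i` at the moments `(U, V)`. -/
noncomputable def momentPull (M : Market) {N : ℕ} (U : Fin N → ℝ)
    (V : Matrix (Fin N) (Fin N) ℝ) (i : Fin N) : ℝ :=
  M.pull (U i) (othersAvg U i) (regCoeff V i)

section MomentPull

variable {M : Market} {N : ℕ} {U : Fin N → ℝ} {V : Matrix (Fin N) (Fin N) ℝ} {i : Fin N}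

theorem adj_eq_postedPrice_sub (hV : 0 < V i i) :
    M.adj U V i = M.postedPrice (U i) (othersAvg U i) (regCoeff V i) - U i := by
  rw [adj, price_eq_postedPrice hV]

theorem Admissible.mul_adj_nonneg (hM : M.Admissible) (hN : 2 ≤ N) (hU : U ∈ M.priceBox N)
    (hV : 0 < V i i) {s : ℝ} (hs : 0 < s * M.momentPull U V i) : 0 ≤ s * M.adj U V i := by
  have hadj : 0 ≤ M.adj U V i * M.momentPull U V i := by
    rw [adj_eq_postedPrice_sub hV]
    exact hM.postedPrice_sub_mul_pull_nonneg (hU i) (othersAvg_mem_of_mem_priceBox hN hU i).1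
  refine nonneg_of_mul_nonneg_left ?_ hs
  linarith [mul_nonneg (sq_nonneg s) hadj]

theorem Admissible.abs_adj_mul_minSlope_le (hM : M.Admissible) (hN : 2 ≤ N)
    (hU : U ∈ M.priceBox N) (hV : 0 < V i i) :
    |M.adj U V i| * M.minSlope ≤ |M.momentPull U V i| := by
  rw [adj_eq_postedPrice_sub hV]
  exact hM.abs_postedPrice_sub_mul_le (hU i) (othersAvg_mem_of_mem_priceBox hN hU i).1

theorem adj_pos_of_momentPull_pos (hU : U i < M.Pmax) (hV : 0 < V i i)
    (hp : 0 < M.momentPull U V i) : 0 < M.adj U V i := by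
  rw [adj_eq_postedPrice_sub hV, sub_pos]
  exact lt_postedPrice_of_pull_pos hU hp

theorem momentPull_diagonal (M : Market) (U d : Fin N → ℝ) (i : Fin N) :
    M.momentPull U (Matrix.diagonal d) i = M.pull (U i) (othersAvg U i) 0 := by
  have : othersAvg (Matrix.diagonal d i) i = 0 := by
    rw [othersAvg, Finset.sum_eq_zero fun j hj =>
      Matrix.diagonal_apply_ne' d (Finset.ne_of_mem_erase hj), zero_div]
  rw [momentPull, regCoeff, this, zero_div]

theorem Admissible.pull_zero_eq (hM : M.Admissible) (u ubar : ℝ) :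
    M.pull u ubar 0 = 2 * M.b * (M.BR ubar - u) := by
  have := hM.b_pos.ne'
  unfold pull BR
  field_simp
  ring

theorem Admissible.momentPull_diagonal_neg_iff (hM : M.Admissible) {U d : Fin N → ℝ} :
    M.momentPull U (Matrix.diagonal d) i < 0 ↔ M.BR (othersAvg U i) < U i := by
  rw [momentPull_diagonal, hM.pull_zero_eq, ← neg_pos, ← mul_neg, neg_sub,
    mul_pos_iff_of_pos_left (mul_pos two_pos hM.b_pos), sub_pos]

theorem Admissible.momentPull_diagonal_pos_iff (hM : M.Admissible) {U d : Fin N → ℝ} :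
    0 < M.momentPull U (Matrix.diagonal d) i ↔ U i < M.BR (othersAvg U i) := by
  rw [momentPull_diagonal, hM.pull_zero_eq,
    mul_pos_iff_of_pos_left (mul_pos two_pos hM.b_pos), sub_pos]

theorem Admissible.nash_lt_of_pull_neg (hM : M.Admissible) (hN : 2 ≤ N)
    (hU : ∀ i, M.pull (U i) (othersAvg U i) 0 < 0) (i : Fin N) : M.nash < U i := by
  have : Nonempty (Fin N) := ⟨i⟩
  obtain ⟨k, hk⟩ := Finite.exists_min U
  refine lt_of_lt_of_le ?_ (hk i)
  have hpull := hU k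
  unfold pull at hpull
  refine lt_of_mul_lt_mul_left ?_ (by linarith [hM.c_lt_b, hM.c_pos] : 0 ≤ 2 * M.b - M.c)
  linarith [hM.nash_mul,
    mul_le_mul_of_nonneg_left (le_othersAvg hN (i := k) fun j _ => hk j) hM.c_pos.le]

theorem Admissible.lt_nash_of_pull_pos (hM : M.Admissible) (hN : 2 ≤ N)
    (hU : ∀ i, 0 < M.pull (U i) (othersAvg U i) 0) (i : Fin N) : U i < M.nash := by
  have : Nonempty (Fin N) := ⟨i⟩
  obtain ⟨k, hk⟩ := Finite.exists_max U
  refine lt_of_le_of_lt (hk i) ?_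
  have hpull := hU k
  unfold pull at hpull
  refine lt_of_mul_lt_mul_left ?_ (by linarith [hM.c_lt_b, hM.c_pos] : 0 ≤ 2 * M.b - M.c)
  linarith [hM.nash_mul,
    mul_le_mul_of_nonneg_left (othersAvg_le hN (i := k) fun j _ => hk j) hM.c_pos.le]

end MomentPull

section Dynamics

variable {M : Market} {N : ℕ} {μ : Fin N → ℝ} {S : Matrix (Fin N) (Fin N) ℝ}
  {U : ℝ → Fin N → ℝ} {V : ℝ → Matrix (Fin N) (Fin N) ℝ}

theorem IsSolution.V_diag_pos (hS : ∀ i, 0 < S i i) (h : M.IsSolution μ S U V) {τ : ℝ}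
    (hτ : 1 ≤ τ) (i : Fin N) : 0 < V τ i i :=
  (hS i).trans_le (h.le_V_diag hτ i)

theorem IsSolution.hasDerivWithinAt_othersAvg_U (h : M.IsSolution μ S U V) {τ : ℝ}
    (hτ : 1 ≤ τ) (i : Fin N) :
    HasDerivWithinAt (fun t => othersAvg (U t) i) (othersAvg (M.adj (U τ) (V τ)) i / τ)
      (Ici 1) τ := by
  rw [← othersAvg_div]
  exact hasDerivWithinAt_othersAvg (fun j => h.deriv_U τ hτ j) i

theorem IsSolution.hasDerivWithinAt_regCoeff (hS : ∀ i, 0 < S i i) (h : M.IsSolution μ S U V)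
    {τ : ℝ} (hτ : 1 ≤ τ) (i : Fin N) :
    HasDerivWithinAt (fun t => regCoeff (V t) i)
      (M.adj (U τ) (V τ) i * (othersAvg (M.adj (U τ) (V τ)) i -
        regCoeff (V τ) i * M.adj (U τ) (V τ) i) / V τ i i) (Ici 1) τ := by
  have hV := (h.V_diag_pos hS hτ i).ne'
  refine ((hasDerivWithinAt_othersAvg (fun j => h.deriv_V τ hτ i j) i).fun_div
    (h.deriv_V τ hτ i i) hV).congr_deriv ?_
  change (othersAvg (fun j => M.adj (U τ) (V τ) i * M.adj (U τ) (V τ) j) i * V τ i i -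
    othersAvg (V τ i) i * (M.adj (U τ) (V τ) i * M.adj (U τ) (V τ) i)) / V τ i i ^ 2 = _
  rw [othersAvg_const_mul, regCoeff]
  field_simp

theorem IsSolution.hasDerivWithinAt_momentPull (hS : ∀ i, 0 < S i i) (h : M.IsSolution μ S U V)
    {τ : ℝ} (hτ : 1 ≤ τ) (i : Fin N) :
    HasDerivWithinAt (fun t => M.momentPull (U t) (V t) i)
      (M.c * othersAvg (M.adj (U τ) (V τ)) i / τ + M.adj (U τ) (V τ) i *
        ((M.c * regCoeff (V τ) i - 2 * M.b) / τ + M.c * U τ i *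
          (othersAvg (M.adj (U τ) (V τ)) i - regCoeff (V τ) i * M.adj (U τ) (V τ) i) / V τ i i))
      (Ici 1) τ := by
  have hU : HasDerivWithinAt (fun t => U t i) (M.adj (U τ) (V τ) i / τ) (Ici 1) τ :=
    h.deriv_U τ hτ i
  refine (((((h.hasDerivWithinAt_othersAvg_U hτ i).const_mul M.c).const_add M.a).fun_sub
    (hU.const_mul (2 * M.b))).fun_add
      ((hU.const_mul M.c).fun_mul (h.hasDerivWithinAt_regCoeff hS hτ i))).congr_deriv ?_
  ring

theorem IsSolution.exists_bound_momentPull_coeff (hM : M.Admissible) (hN : 2 ≤ N)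
    (hμ : μ ∈ M.priceBox N) (hS : ∀ i, 0 < S i i) (h : M.IsSolution μ S U V) (T : ℝ)
    (i : Fin N) :
    ∃ C, ∀ τ ∈ Icc 1 T, |(M.c * regCoeff (V τ) i - 2 * M.b) / τ + M.c * U τ i *
      (othersAvg (M.adj (U τ) (V τ)) i - regCoeff (V τ) i * M.adj (U τ) (V τ) i) / V τ i i|
        ≤ C := by
  have hadj := h.continuousOn_adj hM hN hμ hS
  have hadj_avg : ContinuousOn (fun t => othersAvg (M.adj (U t) (V t)) i) (Ici 1) :=
    (contDiff_othersAvg (n := 0) i).continuous.comp_continuousOn (continuousOn_pi.mpr hadj)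
  have hU : ContinuousOn (fun t => U t i) (Ici 1) := fun t ht =>
    (h.deriv_U t ht i).continuousWithinAt
  have hV : ContinuousOn (fun t => V t i i) (Ici 1) := fun t ht =>
    (h.deriv_V t ht i i).continuousWithinAt
  have hρ : ContinuousOn (fun t => regCoeff (V t) i) (Ici 1) := fun t ht =>
    (h.hasDerivWithinAt_regCoeff hS ht i).continuousWithinAt
  have ht₀ : ∀ t ∈ Ici (1 : ℝ), t ≠ 0 := fun t ht => (one_pos.trans_le ht).ne'
  have hV₀ : ∀ t ∈ Ici (1 : ℝ), V t i i ≠ 0 := fun t ht => (h.V_diag_pos hS ht i).ne'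
  have hcoeff := (((hρ.const_mul M.c).sub (continuousOn_const (c := 2 * M.b))).div
    continuousOn_id ht₀).add (((hU.const_mul M.c).mul (hadj_avg.sub (hρ.mul (hadj i)))).div hV hV₀)
  exact isCompact_Icc.exists_bound_of_continuousOn (hcoeff.mono Icc_subset_Ici_self)

/- As long as all pulls have the sign of `s`, so do all adjustments, and the averages of the
competitors' adjustments only reinforce the pulls. The rest of the derivative is proportional to the
own adjustment, hence bounded by a multiple of the pull. -/
theorem IsSolution.mul_momentPull_pos (hM : M.Admissible) (hN : 2 ≤ N)
    (hμ : μ ∈ M.priceBox N) (hS : ∀ i, 0 < S i i) (h : M.IsSolution μ S U V) {s : ℝ}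
    (hs : ∀ i, 0 < s * M.momentPull μ S i) :
    ∀ τ, 1 ≤ τ → ∀ i, 0 < s * M.momentPull (U τ) (V τ) i := by
  refine forall_pos_of_neg_mul_le_deriv
    (fun i t ht => (h.hasDerivWithinAt_momentPull hS ht i).const_mul s)
    (by simpa only [h.init_U, h.init_V] using hs) fun i T => ?_
  obtain ⟨C, hC⟩ := h.exists_bound_momentPull_coeff hM hN hμ hS T i
  refine ⟨C / M.minSlope, fun t ht hpos => ?_⟩
  set D := M.adj (U t) (V t)
  set R := (M.c * regCoeff (V t) i - 2 * M.b) / t +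
    M.c * U t i * (othersAvg D i - regCoeff (V t) i * D i) / V t i i
  have hU := h.U_mem hM hμ ht.1
  have hV := h.V_diag_pos hS ht.1
  have hD : ∀ j, 0 ≤ s * D j := fun j => hM.mul_adj_nonneg hN hU (hV j) (hpos j)
  have hD_avg : 0 ≤ s * othersAvg D i :=
    othersAvg_const_mul s D i ▸ othersAvg_nonneg fun j _ => hD j
  have hD_le : s * D i ≤ s * M.momentPull (U t) (V t) i / M.minSlope := by
    rw [le_div_iff₀ hM.minSlope_pos]
    calc s * D i * M.minSlope = |s| * (|D i| * M.minSlope) := by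
          rw [← mul_assoc, ← abs_mul, abs_of_nonneg (hD i)]
      _ ≤ |s| * |M.momentPull (U t) (V t) i| :=
          mul_le_mul_of_nonneg_left (hM.abs_adj_mul_minSlope_le hN hU (hV i)) (abs_nonneg s)
      _ = s * M.momentPull (U t) (V t) i := by rw [← abs_mul, abs_of_pos (hpos i)]
  have hself : |s * D i * R| ≤ s * M.momentPull (U t) (V t) i / M.minSlope * C := by
    rw [abs_mul, abs_of_nonneg (hD i)]
    exact mul_le_mul hD_le (hC t ht) (abs_nonneg R) ((hD i).trans hD_le)
  have hothers : 0 ≤ M.c * (s * othersAvg D i) / t :=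
    div_nonneg (mul_nonneg hM.c_pos.le hD_avg) (zero_le_one.trans ht.1)
  calc -(C / M.minSlope) * (s * M.momentPull (U t) (V t) i)
      = -(s * M.momentPull (U t) (V t) i / M.minSlope * C) := by ring
    _ ≤ M.c * (s * othersAvg D i) / t + s * D i * R := by linarith [neg_abs_le (s * D i * R)]
    _ = s * (M.c * othersAvg D i / t + D i * R) := by ring

theorem IsSolution.V_nonneg (hS : ∀ i j, 0 ≤ S i j) (h : M.IsSolution μ S U V)
    (hadj : ∀ t, 1 ≤ t → ∀ i j, 0 ≤ M.adj (U t) (V t) i * M.adj (U t) (V t) j) {τ : ℝ}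
    (hτ : 1 ≤ τ) (i j : Fin N) : 0 ≤ V τ i j := by
  have := monotoneOn_Ici_of_hasDerivWithinAt_nonneg (fun t ht => h.deriv_V t ht i j)
    (fun t ht => hadj t ht i j) self_mem_Ici hτ hτ
  exact (hS i j).trans (by simpa only [h.init_V] using this)

theorem IsSolution.regCoeff_nonneg (hS : ∀ i j, 0 ≤ S i j) (h : M.IsSolution μ S U V)
    (hadj : ∀ t, 1 ≤ t → ∀ i j, 0 ≤ M.adj (U t) (V t) i * M.adj (U t) (V t) j) {τ : ℝ}
    (hτ : 1 ≤ τ) (i : Fin N) : 0 ≤ regCoeff (V τ) i :=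
  div_nonneg (othersAvg_nonneg fun _ _ => h.V_nonneg hS hadj hτ _ _) (h.V_nonneg hS hadj hτ i i)

theorem IsSolution.nash_lt_price_of_momentPull_neg (hM : M.Admissible) (hN : 2 ≤ N)
    (hμ : μ ∈ M.priceBox N) (hS : ∀ i, 0 < S i i) (hS₀ : ∀ i j, 0 ≤ S i j)
    (h : M.IsSolution μ S U V) (hpull : ∀ i, M.momentPull μ S i < 0) {τ : ℝ} (hτ : 1 ≤ τ)
    (i : Fin N) : M.nash < M.price (U τ) (V τ) i := by
  have hpull' := h.mul_momentPull_pos hM hN hμ hS (s := -1) (by simpa using hpull)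
  have hadj : ∀ t, 1 ≤ t → ∀ i j, 0 ≤ M.adj (U t) (V t) i * M.adj (U t) (V t) j := by
    intro t ht i j
    have hneg : ∀ k, 0 ≤ -1 * M.adj (U t) (V t) k := fun k =>
      hM.mul_adj_nonneg hN (h.U_mem hM hμ ht) (h.V_diag_pos hS ht k) (hpull' t ht k)
    linarith [mul_nonneg (hneg i) (hneg j)]
  have hU := h.U_mem hM hμ hτ
  have hρ := h.regCoeff_nonneg hS₀ hadj hτ
  have hnash : ∀ j, M.nash < U τ j := hM.nash_lt_of_pull_neg hN fun j =>
    calc M.pull (U τ j) (othersAvg (U τ) j) 0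
        ≤ M.momentPull (U τ) (V τ) j := hM.pull_mono (hM.Pmin_pos.le.trans (hU j).1) (hρ j)
      _ < 0 := by linarith [hpull' τ hτ j]
  rw [price_eq_postedPrice (h.V_diag_pos hS hτ i)]
  exact hM.nash_lt_postedPrice (hU i).2 (lt_othersAvg hN fun j _ => hnash j) (hρ i)

end Dynamics

/-- The total shortfall of the prices `U` below the Nash price, the Lyapunov quantity of the
bound on the regression coefficients. -/
noncomputable def shortfall (M : Market) {N : ℕ} (U : Fin N → ℝ) : ℝ :=
  ∑ j, (M.nash - U j)

/-- A lower bound for the price increase per unit of regression coefficient. -/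
noncomputable def gain (M : Market) : ℝ := M.c * M.Pmin / (2 * M.b)

/-- The threshold below which regression coefficients count as small in
`Admissible.mul_adj_lt_othersAvg_adj_or`. -/
noncomputable def smallCoeff (M : Market) : ℝ :=
  min ((M.Pmax - M.nash) / M.gain) (M.gain / (4 * M.nash))

section BelowNash

variable {M : Market} {N : ℕ} {U : Fin N → ℝ} {V : Matrix (Fin N) (Fin N) ℝ} {i : Fin N}

theorem Admissible.gain_pos (hM : M.Admissible) : 0 < M.gain :=
  div_pos (mul_pos hM.c_pos hM.Pmin_pos) (mul_pos two_pos hM.b_pos)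

theorem Admissible.gain_le_half_nash (hM : M.Admissible) : M.gain ≤ M.nash / 2 := by
  have hPmin : M.Pmin ≤ M.nash := hM.Pmin_le_nash
  rw [gain, div_le_iff₀ (mul_pos two_pos hM.b_pos)]
  linarith [mul_le_mul hM.c_lt_b.le hPmin hM.Pmin_pos.le hM.b_pos.le]

theorem Admissible.smallCoeff_pos (hM : M.Admissible) : 0 < M.smallCoeff :=
  lt_min (div_pos (sub_pos.mpr hM.nash_lt_Pmax) hM.gain_pos)
    (div_pos hM.gain_pos (mul_pos four_pos hM.nash_pos))

theorem Admissible.gain_mul_le_of_le_smallCoeff (hM : M.Admissible) {ρ : ℝ}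
    (hρ : ρ ≤ M.smallCoeff) : M.gain * ρ ≤ M.Pmax - M.nash :=
  (le_div_iff₀' hM.gain_pos).mp (hρ.trans (min_le_left _ _))

theorem Admissible.nash_mul_le_of_le_smallCoeff (hM : M.Admissible) {ρ : ℝ}
    (hρ : ρ ≤ M.smallCoeff) : 4 * M.nash * ρ ≤ M.gain :=
  (le_div_iff₀' (mul_pos four_pos hM.nash_pos)).mp (hρ.trans (min_le_right _ _))

theorem Admissible.le_half_of_le_smallCoeff (hM : M.Admissible) {ρ : ℝ}
    (hρ : ρ ≤ M.smallCoeff) : ρ ≤ 1 / 2 := by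
  have hnash := hM.nash_pos
  refine le_of_mul_le_mul_left ?_ hnash
  linarith [hM.nash_mul_le_of_le_smallCoeff hρ, hM.gain_le_half_nash]

theorem nash_sub_le_shortfall (hU : ∀ j, U j ≤ M.nash) (i : Fin N) :
    M.nash - U i ≤ M.shortfall U :=
  Finset.single_le_sum (f := fun j => M.nash - U j) (fun j _ => sub_nonneg.mpr (hU j))
    (Finset.mem_univ i)

theorem othersAvg_nash_sub_le_shortfall (hN : 2 ≤ N) (hU : ∀ j, U j ≤ M.nash) (i : Fin N) :
    othersAvg (fun j => M.nash - U j) i ≤ M.shortfall U :=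
  othersAvg_le_sum hN (fun j => sub_nonneg.mpr (hU j)) i

theorem shortfall_nonneg (hU : ∀ j, U j ≤ M.nash) : 0 ≤ M.shortfall U :=
  Finset.sum_nonneg fun j _ => sub_nonneg.mpr (hU j)

theorem Admissible.momentPull_eq_nash_sub (hM : M.Admissible) (hN : 2 ≤ N) :
    M.momentPull U V i = 2 * M.b * (M.nash - U i)
      - M.c * othersAvg (fun j => M.nash - U j) i + M.c * U i * regCoeff V i := by
  rw [othersAvg_sub, othersAvg_const hN, momentPull, pull, ← hM.nash_mul]
  ring

theorem Admissible.nash_sub_add_le_adj (hM : M.Admissible) (hN : 2 ≤ N) (hU : U ∈ M.priceBox N)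
    (hU_le : ∀ j, U j ≤ M.nash) (hV : 0 < V i i) (hρ : 0 ≤ regCoeff V i)
    (hp : 0 ≤ M.momentPull U V i) {x : ℝ}
    (hx : x ≤ M.gain * regCoeff V i) (hx' : x ≤ M.Pmax - M.nash) :
    M.nash - U i - M.c / (2 * M.b) * othersAvg (fun j => M.nash - U j) i + x ≤ M.adj U V i := by
  have hb := hM.b_pos
  have hc := hM.c_pos
  rw [adj_eq_postedPrice_sub hV]
  refine le_trans (le_min ?_ ?_) (hM.min_le_postedPrice_sub hρ hp)
  · have hPmin : M.c * M.Pmin * regCoeff V i ≤ M.c * U i * regCoeff V i :=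
      mul_le_mul_of_nonneg_right (mul_le_mul_of_nonneg_left (hU i).1 hc.le) hρ
    calc _ ≤ M.nash - U i - M.c / (2 * M.b) * othersAvg (fun j => M.nash - U j) i
          + M.gain * regCoeff V i := by linarith
      _ = (2 * M.b * (M.nash - U i) - M.c * othersAvg (fun j => M.nash - U j) i
          + M.c * M.Pmin * regCoeff V i) / (2 * M.b) := by rw [gain]; field_simp
      _ ≤ M.momentPull U V i / (2 * M.b) := by
          rw [hM.momentPull_eq_nash_sub hN]
          gcongr
  · have havg : 0 ≤ M.c / (2 * M.b) * othersAvg (fun j => M.nash - U j) i :=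
      mul_nonneg (by positivity) (othersAvg_nonneg fun j _ => sub_nonneg.mpr (hU_le j))
    linarith

theorem Admissible.mul_shortfall_le_sum_adj (hM : M.Admissible) (hN : 2 ≤ N)
    (hU : U ∈ M.priceBox N) (hU_le : ∀ j, U j ≤ M.nash) (hV : ∀ j, 0 < V j j)
    (hρ : ∀ j, 0 ≤ regCoeff V j) (hp : ∀ j, 0 ≤ M.momentPull U V j) :
    (1 - M.c / (2 * M.b)) * M.shortfall U ≤ ∑ j, M.adj U V j := by
  calc (1 - M.c / (2 * M.b)) * M.shortfall U
      = ∑ j, (M.nash - U j - M.c / (2 * M.b) * othersAvg (fun k => M.nash - U k) j + 0) := by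
        simp only [add_zero]
        rw [Finset.sum_sub_distrib, ← Finset.mul_sum, sum_othersAvg hN, shortfall]
        ring
    _ ≤ ∑ j, M.adj U V j := Finset.sum_le_sum fun j _ =>
        hM.nash_sub_add_le_adj hN hU hU_le (hV j) (hρ j) (hp j) (mul_nonneg hM.gain_pos.le (hρ j))
          (sub_nonneg.mpr hM.nash_lt_Pmax.le)

theorem Admissible.mul_sub_shortfall_le_adj (hM : M.Admissible) (hN : 2 ≤ N)
    (hU : U ∈ M.priceBox N) (hU_le : ∀ j, U j ≤ M.nash) (hV : 0 < V i i) {ρ : ℝ} (hρ : 0 ≤ ρ)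
    (hρ_le : ρ ≤ regCoeff V i) (hρ_Pmax : M.gain * ρ ≤ M.Pmax - M.nash)
    (hp : 0 ≤ M.momentPull U V i) :
    M.gain * ρ - M.shortfall U ≤ M.adj U V i := by
  have hb := hM.b_pos
  have hadj := hM.nash_sub_add_le_adj hN hU hU_le hV (hρ.trans hρ_le) hp
    (mul_le_mul_of_nonneg_left hρ_le hM.gain_pos.le) hρ_Pmax
  have havg : M.c / (2 * M.b) * othersAvg (fun j => M.nash - U j) i ≤ 1 * M.shortfall U :=
    mul_le_mul ((div_le_one (by positivity)).mpr (by linarith [hM.c_lt_b]))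
      (othersAvg_nash_sub_le_shortfall hN hU_le i)
      (othersAvg_nonneg fun j _ => sub_nonneg.mpr (hU_le j)) zero_le_one
  linarith [sub_nonneg.mpr (hU_le i)]

theorem Admissible.adj_le_shortfall_add (hM : M.Admissible) (hN : 2 ≤ N)
    (hU : U ∈ M.priceBox N) (hU_le : ∀ j, U j ≤ M.nash) (hV : 0 < V i i)
    (hρ : 0 ≤ regCoeff V i) (hρ_le : M.c * regCoeff V i ≤ M.b / 2)
    (hp : 0 ≤ M.momentPull U V i) :
    M.adj U V i ≤ 2 * M.shortfall U + M.nash * regCoeff V i := by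
  have hb := hM.b_pos
  rw [adj_eq_postedPrice_sub hV]
  refine (hM.postedPrice_sub_le (hU i) hρ_le hp).trans ((div_le_iff₀ hb).mpr ?_)
  change M.momentPull U V i ≤ _
  rw [hM.momentPull_eq_nash_sub hN]
  have havg : 0 ≤ M.c * othersAvg (fun j => M.nash - U j) i :=
    mul_nonneg hM.c_pos.le (othersAvg_nonneg fun j _ => sub_nonneg.mpr (hU_le j))
  have hself := mul_le_mul_of_nonneg_left (nash_sub_le_shortfall hU_le i) hb.le
  have hcoeff : M.c * U i * regCoeff V i ≤ M.b * M.nash * regCoeff V i :=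
    mul_le_mul_of_nonneg_right
      (mul_le_mul hM.c_lt_b.le (hU_le i) (hM.Pmin_pos.le.trans (hU i).1) hb.le) hρ
  linarith

/- If the shortfall is small compared with `ρ = regCoeff V i`, the competitors' adjustments are of
order `ρ` and dominate `ρ` times the own adjustment; otherwise the own adjustment is of the order of
the shortfall. -/
theorem Admissible.mul_adj_lt_othersAvg_adj_or (hM : M.Admissible) (hN : 2 ≤ N)
    (hU : U ∈ M.priceBox N) (hU_le : ∀ j, U j ≤ M.nash) (hV : ∀ j, 0 < V j j)
    (hp : ∀ j, 0 ≤ M.momentPull U V j) (hρ : 0 < regCoeff V i)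
    (hρ_small : regCoeff V i ≤ M.smallCoeff) (hmin : ∀ j, regCoeff V i ≤ regCoeff V j) :
    regCoeff V i * M.adj U V i < othersAvg (M.adj U V) i ∨
      0 < M.shortfall U ∧ M.adj U V i ≤ (2 + 4 * M.nash / M.gain) * M.shortfall U := by
  have hgain := hM.gain_pos
  have hnash := hM.nash_pos
  have hhalf := hM.le_half_of_le_smallCoeff hρ_small
  have hnash_mul := hM.nash_mul_le_of_le_smallCoeff hρ_small
  have hc : M.c * regCoeff V i ≤ M.b * (1 / 2) :=
    mul_le_mul hM.c_lt_b.le hhalf hρ.le hM.b_pos.le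
  have hown := hM.adj_le_shortfall_add hN hU hU_le (hV i) hρ.le (by linarith) (hp i)
  have hothers : M.gain * regCoeff V i - M.shortfall U ≤ othersAvg (M.adj U V) i :=
    le_othersAvg hN fun j _ => hM.mul_sub_shortfall_le_adj hN hU hU_le (hV j) hρ.le (hmin j)
      (hM.gain_mul_le_of_le_smallCoeff hρ_small) (hp j)
  have hE := shortfall_nonneg hU_le
  set ρ := regCoeff V i
  set E := M.shortfall U
  rcases le_or_gt E (M.gain * ρ / 4) with hsmall | hlarge
  · left
    have hgain_mul : 0 < M.gain * ρ := mul_pos hgain hρ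
    calc ρ * M.adj U V i ≤ ρ * (2 * E + M.nash * ρ) := mul_le_mul_of_nonneg_left hown hρ.le
      _ = 2 * (ρ * E) + ρ * (4 * M.nash * ρ) / 4 := by ring
      _ ≤ 2 * (1 / 2 * E) + ρ * M.gain / 4 := by gcongr
      _ < M.gain * ρ - E := by linarith
      _ ≤ othersAvg (M.adj U V) i := hothers
  · right
    refine ⟨(by positivity : 0 < M.gain * ρ / 4).trans hlarge, hown.trans ?_⟩
    have hnash_le : M.nash * ρ ≤ 4 * M.nash / M.gain * E :=
      calc M.nash * ρ = 4 * M.nash / M.gain * (M.gain * ρ / 4) := by field_simp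
        _ ≤ 4 * M.nash / M.gain * E := by gcongr
    linarith

end BelowNash

section LowerCone

variable {M : Market} {N : ℕ} {μ : Fin N → ℝ} {S : Matrix (Fin N) (Fin N) ℝ}
  {U : ℝ → Fin N → ℝ} {V : ℝ → Matrix (Fin N) (Fin N) ℝ}

theorem IsSolution.U_lt_Pmax (hM : M.Admissible) (hμ : ∀ i, μ i < M.Pmax)
    (h : M.IsSolution μ S U V) {τ : ℝ} (hτ : 1 ≤ τ) (i : Fin N) : U τ i < M.Pmax := by
  have hmono := monotoneOn_Ici_of_hasDerivWithinAt_nonneg (f := fun t => t * M.Pmax - t * U t i)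
    (fun t ht => ((hasDerivWithinAt_id t _).mul_const M.Pmax).sub (h.hasDerivWithinAt_mul_U ht i))
    (fun t _ => by linarith [(hM.price_mem (U t) (V t) i).2]) self_mem_Ici hτ hτ
  simp only [one_mul, h.init_U, ← mul_sub] at hmono
  exact sub_pos.mp (pos_of_mul_pos_right ((sub_pos.mpr (hμ i)).trans_le hmono)
    (zero_le_one.trans hτ))

theorem IsSolution.adj_pos (hM : M.Admissible) (hN : 2 ≤ N) (hμ : μ ∈ M.priceBox N)
    (hμ_lt : ∀ i, μ i < M.Pmax) (hS : ∀ i, 0 < S i i) (h : M.IsSolution μ S U V)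
    (hpull : ∀ i, 0 < M.momentPull μ S i) {τ : ℝ} (hτ : 1 ≤ τ) (i : Fin N) :
    0 < M.adj (U τ) (V τ) i :=
  adj_pos_of_momentPull_pos (h.U_lt_Pmax hM hμ_lt hτ i) (h.V_diag_pos hS hτ i) <| by
    simpa using h.mul_momentPull_pos hM hN hμ hS (s := 1) (by simpa using hpull) τ hτ i

theorem IsSolution.monotoneOn_U (h : M.IsSolution μ S U V)
    (hadj : ∀ t, 1 ≤ t → ∀ i, 0 ≤ M.adj (U t) (V t) i) (i : Fin N) :
    MonotoneOn (fun t => U t i) (Ici 1) :=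
  monotoneOn_Ici_of_hasDerivWithinAt_nonneg (fun t ht => h.deriv_U t ht i)
    fun t ht => div_nonneg (hadj t ht i) (zero_le_one.trans ht)

theorem IsSolution.V_pos (hS : ∀ i j, 0 ≤ S i j) (h : M.IsSolution μ S U V)
    (hadj : ∀ t, 1 ≤ t → ∀ i, 0 < M.adj (U t) (V t) i) {τ : ℝ} (hτ : 1 < τ) (i j : Fin N) :
    0 < V τ i j := by
  have hmono : StrictMonoOn (fun t => V t i j) (Ici 1) :=
    strictMonoOn_of_hasDerivWithinAt_pos (convex_Ici 1)
      (fun t ht => (h.deriv_V t ht i j).continuousWithinAt)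
      (fun t ht => (h.deriv_V t (interior_subset ht) i j).mono interior_subset)
      (fun t ht => mul_pos (hadj t (interior_subset ht) i) (hadj t (interior_subset ht) j))
  exact (hS i j).trans_lt (by simpa only [h.init_V] using hmono self_mem_Ici hτ.le hτ)

theorem IsSolution.regCoeff_pos (hN : 2 ≤ N) (hS : ∀ i j, 0 ≤ S i j) (h : M.IsSolution μ S U V)
    (hadj : ∀ t, 1 ≤ t → ∀ i, 0 < M.adj (U t) (V t) i) {τ : ℝ} (hτ : 1 < τ) (i : Fin N) :
    0 < regCoeff (V τ) i :=
  div_pos (lt_othersAvg hN fun j _ => h.V_pos hS hadj hτ i j) (h.V_pos hS hadj hτ i i)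

theorem IsSolution.hasDerivWithinAt_mul_shortfall_sq (h : M.IsSolution μ S U V) {τ : ℝ}
    (hτ : 1 ≤ τ) :
    HasDerivWithinAt (fun t => t * M.shortfall (U t) ^ 2)
      (M.shortfall (U τ) ^ 2 - 2 * M.shortfall (U τ) * ∑ j, M.adj (U τ) (V τ) j) (Ici 1) τ := by
  have hτ₀ : τ ≠ 0 := (one_pos.trans_le hτ).ne'
  have hE : HasDerivWithinAt (fun t => M.shortfall (U t))
      (∑ j, -(M.adj (U τ) (V τ) j / τ)) (Ici 1) τ :=
    HasDerivWithinAt.fun_sum fun j _ => (h.deriv_U τ hτ j).const_sub M.nash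
  refine ((hasDerivWithinAt_id τ _).fun_mul (hE.fun_pow 2)).congr_deriv ?_
  rw [Finset.sum_neg_distrib, ← Finset.sum_div]
  simp only [id]
  field_simp
  ring

end LowerCone

section RegCoeffBound

variable {M : Market} {N : ℕ}

theorem Admissible.shortfall_sq_sub_le (hM : M.Admissible) (hN : 2 ≤ N) {U : Fin N → ℝ}
    {V : Matrix (Fin N) (Fin N) ℝ} (hU : U ∈ M.priceBox N) (hU_le : ∀ j, U j ≤ M.nash)
    (hV : ∀ j, 0 < V j j) (hρ : ∀ j, 0 ≤ regCoeff V j) (hp : ∀ j, 0 ≤ M.momentPull U V j) :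
    M.shortfall U ^ 2 - 2 * M.shortfall U * ∑ j, M.adj U V j
      ≤ -((1 - M.c / M.b) * M.shortfall U ^ 2) := by
  have hsum := mul_le_mul_of_nonneg_left (hM.mul_shortfall_le_sum_adj hN hU hU_le hV hρ hp)
    (mul_nonneg zero_le_two (shortfall_nonneg hU_le))
  have hhalf : M.c / (2 * M.b) = M.c / M.b / 2 := by rw [mul_comm, div_div]
  rw [hhalf] at hsum
  linarith

theorem Admissible.one_sub_div_pos (hM : M.Admissible) : 0 < 1 - M.c / M.b :=
  sub_pos.mpr ((div_lt_one hM.b_pos).mpr hM.c_lt_b)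

theorem Admissible.mul_regCoeff_lt_deriv (hM : M.Admissible) (hN : 2 ≤ N) {U : Fin N → ℝ}
    {V : Matrix (Fin N) (Fin N) ℝ} {i : Fin N} {v K : ℝ} (hU : U ∈ M.priceBox N)
    (hU_le : ∀ j, U j ≤ M.nash) (hv : 0 < v) (hvV : v ≤ V i i) (hV : ∀ j, 0 < V j j)
    (hp : ∀ j, 0 ≤ M.momentPull U V j) (hadj : ∀ j, 0 < M.adj U V j) (hρ : 0 < regCoeff V i)
    (hρ_small : regCoeff V i ≤ M.smallCoeff) (hmin : ∀ j, regCoeff V i ≤ regCoeff V j)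
    (hK : (2 + 4 * M.nash / M.gain) ^ 2 / v < K * (1 - M.c / M.b)) :
    K * (M.shortfall U ^ 2 - 2 * M.shortfall U * ∑ j, M.adj U V j) * regCoeff V i
      < M.adj U V i * (othersAvg (M.adj U V) i - regCoeff V i * M.adj U V i) / V i i := by
  have hcases := hM.mul_adj_lt_othersAvg_adj_or hN hU hU_le hV hp hρ hρ_small hmin
  have hdecay := hM.shortfall_sq_sub_le hN hU hU_le hV (fun j => hρ.le.trans (hmin j)) hp
  set ρ := regCoeff V i
  set E := M.shortfall U
  set D := M.adj U V
  set C := 2 + 4 * M.nash / M.gain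
  have hθ := hM.one_sub_div_pos
  have hK₀ : 0 < K := pos_of_mul_pos_left ((by positivity : 0 ≤ C ^ 2 / v).trans_lt hK) hθ.le
  have hbarrier : K * (E ^ 2 - 2 * E * ∑ j, D j) * ρ ≤ -(K * (1 - M.c / M.b) * E ^ 2 * ρ) := by
    linarith [mul_le_mul_of_nonneg_right (mul_le_mul_of_nonneg_left hdecay hK₀.le) hρ.le]
  refine hbarrier.trans_lt ?_
  rcases hcases with hlt | ⟨hE, hle⟩
  · refine lt_of_le_of_lt (neg_nonpos.mpr (by positivity)) ?_
    exact div_pos (mul_pos (hadj i) (sub_pos.mpr hlt)) (hV i)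
  · have hsq : D i ^ 2 / V i i ≤ (C * E) ^ 2 / v :=
      div_le_div₀ (sq_nonneg _) (pow_le_pow_left₀ (hadj i).le hle 2) hv hvV
    have havg : 0 ≤ D i * othersAvg D i / V i i :=
      div_nonneg (mul_nonneg (hadj i).le (othersAvg_nonneg fun j _ => (hadj j).le)) (hV i).le
    calc -(K * (1 - M.c / M.b) * E ^ 2 * ρ) < -(C ^ 2 / v * E ^ 2 * ρ) := by gcongr
      _ = -((C * E) ^ 2 / v * ρ) := by ring
      _ ≤ -(D i ^ 2 / V i i * ρ) := by gcongr
      _ ≤ D i * othersAvg D i / V i i - D i ^ 2 / V i i * ρ := by linarith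
      _ = D i * (othersAvg D i - ρ * D i) / V i i := by ring

variable {μ : Fin N → ℝ} {S : Matrix (Fin N) (Fin N) ℝ} {U : ℝ → Fin N → ℝ}
  {V : ℝ → Matrix (Fin N) (Fin N) ℝ}

theorem IsSolution.mul_shortfall_sq_le (hM : M.Admissible) (hN : 2 ≤ N) (hμ : μ ∈ M.priceBox N)
    (hS : ∀ i, 0 < S i i) (h : M.IsSolution μ S U V)
    (hρ : ∀ t, 1 ≤ t → ∀ i, 0 ≤ regCoeff (V t) i)
    (hp : ∀ t, 1 ≤ t → ∀ i, 0 ≤ M.momentPull (U t) (V t) i)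
    (hU_le : ∀ t, 1 ≤ t → ∀ i, U t i ≤ M.nash) {τ : ℝ} (hτ : 1 ≤ τ) :
    τ * M.shortfall (U τ) ^ 2 ≤ M.shortfall μ ^ 2 := by
  have hmono := monotoneOn_Ici_of_hasDerivWithinAt_nonneg
    (f := fun t => -(t * M.shortfall (U t) ^ 2))
    (fun t ht => (h.hasDerivWithinAt_mul_shortfall_sq ht).fun_neg)
    (fun t ht => neg_nonneg.mpr <|
      (hM.shortfall_sq_sub_le hN (h.U_mem hM hμ ht) (hU_le t ht) (h.V_diag_pos hS ht) (hρ t ht)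
        (hp t ht)).trans
        (neg_nonpos.mpr (mul_nonneg hM.one_sub_div_pos.le (sq_nonneg _))))
    self_mem_Ici hτ hτ
  simpa only [one_mul, h.init_U, neg_le_neg_iff] using hmono

/- The regression coefficients start at `0` when `S` is diagonal, so the barrier is set up at time
`2`; its exponent is a multiple of the decreasing quantity `t * shortfall ^ 2`. -/
theorem IsSolution.exists_pos_le_regCoeff (hM : M.Admissible) (hN : 2 ≤ N)
    (hμ : μ ∈ M.priceBox N) (hS : ∀ i, 0 < S i i) (hS₀ : ∀ i j, 0 ≤ S i j)
    (h : M.IsSolution μ S U V) (hadj : ∀ t, 1 ≤ t → ∀ i, 0 < M.adj (U t) (V t) i)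
    (hp : ∀ t, 1 ≤ t → ∀ i, 0 ≤ M.momentPull (U t) (V t) i)
    (hU_le : ∀ t, 1 ≤ t → ∀ i, U t i ≤ M.nash) :
    ∃ m, 0 < m ∧ ∀ t, 2 ≤ t → ∀ i, m ≤ regCoeff (V t) i := by
  have hone : ∀ t : ℝ, 2 ≤ t → 1 ≤ t := fun t ht => one_le_two.trans ht
  have hsub : Ici (2 : ℝ) ⊆ Ici 1 := Ici_subset_Ici.mpr one_le_two
  obtain ⟨K, hK₀, hK⟩ : ∃ K : ℝ, 0 ≤ K ∧ ∀ i,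
      (2 + 4 * M.nash / M.gain) ^ 2 / S i i < K * (1 - M.c / M.b) :=
    ((eventually_ge_atTop 0).and (eventually_all.mpr fun i =>
      (tendsto_id.atTop_mul_const hM.one_sub_div_pos).eventually_gt_atTop _)).exists
  have hρ : ∀ t, 1 ≤ t → ∀ i, 0 ≤ regCoeff (V t) i := fun t ht =>
    h.regCoeff_nonneg hS₀ (fun t ht i j => (mul_pos (hadj t ht i) (hadj t ht j)).le) ht
  refine exists_pos_le_of_deriv_gt_at_min (φ := fun t => K * (t * M.shortfall (U t) ^ 2))
    (A := 0) (B := K * M.shortfall μ ^ 2)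
    (fun i t ht => (h.hasDerivWithinAt_regCoeff hS (hone t ht) i).mono hsub)
    (fun t ht => ((h.hasDerivWithinAt_mul_shortfall_sq (hone t ht)).const_mul K).mono hsub)
    (fun t ht => ⟨mul_nonneg hK₀ (mul_nonneg (zero_le_two.trans ht) (sq_nonneg _)),
      mul_le_mul_of_nonneg_left
        (h.mul_shortfall_sq_le hM hN hμ hS hρ hp hU_le (hone t ht)) hK₀⟩)
    hM.smallCoeff_pos (h.regCoeff_pos hN hS₀ hadj one_lt_two) fun t ht i hρ_pos hρ_small hmin => ?_
  exact hM.mul_regCoeff_lt_deriv hN (h.U_mem hM hμ (hone t ht)) (hU_le t (hone t ht)) (hS i)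
    (h.le_V_diag (hone t ht) i) (h.V_diag_pos hS (hone t ht)) (hp t (hone t ht))
    (hadj t (hone t ht)) hρ_pos hρ_small hmin (hK i)

end RegCoeffBound

section Limit

variable {M : Market} {N : ℕ}

theorem Admissible.min_pull_le_adj (hM : M.Admissible) {U : Fin N → ℝ}
    {V : Matrix (Fin N) (Fin N) ℝ} {i : Fin N} {ρ : ℝ} (hU : 0 ≤ U i) (hV : 0 < V i i)
    (hρ : 0 ≤ ρ) (hρ_le : ρ ≤ regCoeff V i) (hp : 0 ≤ M.pull (U i) (othersAvg U i) ρ) :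
    min (M.pull (U i) (othersAvg U i) ρ / (2 * M.b)) (M.Pmax - U i) ≤ M.adj U V i := by
  have hmono : M.pull (U i) (othersAvg U i) ρ ≤ M.momentPull U V i := hM.pull_mono hU hρ_le
  rw [adj_eq_postedPrice_sub hV]
  refine le_trans ?_ (hM.min_le_postedPrice_sub (hρ.trans hρ_le) (hp.trans hmono))
  exact min_le_min_right _
    (div_le_div_of_nonneg_right hmono (mul_pos two_pos hM.b_pos).le)

theorem Admissible.eq_nash_of_pull_nonpos_at_min (hM : M.Admissible) (hN : 2 ≤ N)
    {x : Fin N → ℝ} {k : Fin N} (hmin : ∀ j, x k ≤ x j) (hk : x k ≤ M.nash)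
    (hpull : M.pull (x k) (othersAvg x k) 0 ≤ 0) (j : Fin N) : x j = M.nash := by
  have hc := hM.c_pos
  have hb := hM.b_pos
  have hnash := hM.nash_mul
  unfold pull at hpull
  have havg := le_othersAvg hN (i := k) fun j _ => hmin j
  have hxk : x k = M.nash := by
    refine le_antisymm hk (le_of_mul_le_mul_left ?_ (by linarith [hM.c_lt_b] : 0 < 2 * M.b - M.c))
    linarith [mul_le_mul_of_nonneg_left havg hc.le]
  rcases eq_or_ne j k with rfl | hjk
  · exact hxk
  refine le_antisymm (le_of_not_gt fun hj => ?_) (hxk.symm.le.trans (hmin j))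
  have hlt := lt_othersAvg_of_le_of_lt hN (fun l _ => hmin l) hjk (hxk.trans_lt hj)
  rw [hxk] at hlt hpull
  linarith [mul_lt_mul_of_pos_left hlt hc]

variable {μ : Fin N → ℝ} {S : Matrix (Fin N) (Fin N) ℝ} {U : ℝ → Fin N → ℝ}
  {V : ℝ → Matrix (Fin N) (Fin N) ℝ}

/- Otherwise the adjustment stays away from `0`, and `U` grows logarithmically. -/
theorem IsSolution.pull_limit_nonpos (hM : M.Admissible) (hμ : μ ∈ M.priceBox N)
    (hS : ∀ i, 0 < S i i) (h : M.IsSolution μ S U V) {L : Fin N → ℝ}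
    (hL : ∀ i, Tendsto (fun t => U t i) atTop (𝓝 (L i))) {k : Fin N} (hLk : L k < M.Pmax)
    {m : ℝ} (hm : 0 ≤ m) (hρ : ∀ᶠ t in atTop, m ≤ regCoeff (V t) k) :
    M.pull (L k) (othersAvg L k) m ≤ 0 := by
  by_contra! hpos
  have hb := hM.b_pos
  set gap : ℝ → ℝ := fun t =>
    min (M.pull (U t k) (othersAvg (U t) k) m / (2 * M.b)) (M.Pmax - U t k)
  have hgap : Tendsto gap atTop
      (𝓝 (min (M.pull (L k) (othersAvg L k) m / (2 * M.b)) (M.Pmax - L k))) := by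
    unfold gap pull
    exact ((((((tendsto_othersAvg hL k).const_mul M.c).const_add M.a).sub
      ((hL k).const_mul (2 * M.b))).add (((hL k).const_mul M.c).mul_const m)).div_const _).min
        ((hL k).const_sub M.Pmax)
  obtain ⟨δ, hδ, hδ_lt⟩ := exists_between (lt_min (div_pos hpos (mul_pos two_pos hb))
    (sub_pos.mpr hLk))
  obtain ⟨T, hT₁, hT⟩ : ∃ T : ℝ, 1 ≤ T ∧ ∀ t, T ≤ t → δ < gap t ∧ m ≤ regCoeff (V t) k :=
    ((eventually_ge_atTop 1).and
      (eventually_forall_ge_atTop.mpr ((hgap.eventually_const_lt hδ_lt).and hρ))).exists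
  refine not_tendsto_atTop_of_tendsto_nhds (hL k)
    (tendsto_atTop_of_const_le_mul_deriv (one_pos.trans_le hT₁) hδ
      (fun t ht => (h.deriv_U t (hT₁.trans ht) k).mono (Ici_subset_Ici.mpr hT₁)) fun t ht => ?_)
  have ht₁ := hT₁.trans ht
  obtain ⟨hδ_gap, hρt⟩ := hT t ht
  have hpull_t : 0 < M.pull (U t k) (othersAvg (U t) k) m :=
    (div_pos_iff_of_pos_right (mul_pos two_pos hb)).mp
      (hδ.trans (hδ_gap.trans_le (min_le_left _ _)))
  rw [mul_div_cancel₀ _ (one_pos.trans_le ht₁).ne']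
  exact hδ_gap.le.trans (hM.min_pull_le_adj (hM.Pmin_pos.le.trans (h.U_mem hM hμ ht₁ k).1)
    (h.V_diag_pos hS ht₁ k) hm hρt hpull_t.le)

/- If the prices converged to Nash prices from below, the regression coefficients would stay away
from `0`, and at Nash prices a positive regression coefficient leaves a positive pull. -/
theorem IsSolution.exists_forall_nash_lt_U (hM : M.Admissible) (hN : 2 ≤ N)
    (hμ : μ ∈ M.priceBox N) (hS : ∀ i, 0 < S i i) (hS₀ : ∀ i j, 0 ≤ S i j)
    (h : M.IsSolution μ S U V) (hadj : ∀ t, 1 ≤ t → ∀ i, 0 < M.adj (U t) (V t) i)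
    (hp : ∀ t, 1 ≤ t → ∀ i, 0 ≤ M.momentPull (U t) (V t) i) :
    ∃ τ, 1 ≤ τ ∧ ∀ i, M.nash < U τ i := by
  have : Nonempty (Fin N) := ⟨⟨0, by omega⟩⟩
  have hρ : ∀ t, 1 ≤ t → ∀ i, 0 ≤ regCoeff (V t) i := fun t ht =>
    h.regCoeff_nonneg hS₀ (fun t ht i j => (mul_pos (hadj t ht i) (hadj t ht j)).le) ht
  choose L hL hU_le_L using fun i => exists_tendsto_of_monotoneOn_Ici
    (h.monotoneOn_U (fun t ht i => (hadj t ht i).le) i) fun t ht => (h.U_mem hM hμ ht i).2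
  by_contra! hcon
  obtain ⟨k, hk⟩ := Finite.exists_min L
  have hLk : L k ≤ M.nash := by
    by_contra! hlt
    obtain ⟨τ, hτ, hU⟩ := ((eventually_ge_atTop 1).and (eventually_all.mpr fun i =>
      (hL i).eventually_const_lt (hlt.trans_le (hk i)))).exists
    obtain ⟨i, hi⟩ := hcon τ hτ
    exact hi.not_gt (hU i)
  have hLk_lt : L k < M.Pmax := hLk.trans_lt hM.nash_lt_Pmax
  have hL_nash := hM.eq_nash_of_pull_nonpos_at_min hN hk hLk
    (h.pull_limit_nonpos hM hμ hS hL hLk_lt le_rfl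
      ((eventually_ge_atTop 1).mono fun t ht => hρ t ht k))
  obtain ⟨m, hm, hm_le⟩ := h.exists_pos_le_regCoeff hM hN hμ hS hS₀ hadj hp
    fun t ht i => (hU_le_L i t ht).trans_eq (hL_nash i)
  have hpull := h.pull_limit_nonpos hM hμ hS hL hLk_lt hm.le
    ((eventually_ge_atTop 2).mono fun t ht => hm_le t ht k)
  rw [funext hL_nash, othersAvg_const hN, pull] at hpull
  linarith [hM.nash_mul, mul_pos (mul_pos hM.c_pos hM.nash_pos) hm]

theorem IsSolution.exists_forall_nash_lt_price_of_momentPull_pos (hM : M.Admissible)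
    (hN : 2 ≤ N) (hμ : μ ∈ M.priceBox N) (hμ_lt : ∀ i, μ i < M.Pmax) (hS : ∀ i, 0 < S i i)
    (hS₀ : ∀ i j, 0 ≤ S i j) (h : M.IsSolution μ S U V) (hpull : ∀ i, 0 < M.momentPull μ S i) :
    ∃ τ₀, 1 ≤ τ₀ ∧ ∀ τ, τ₀ < τ → ∀ i, M.nash < M.price (U τ) (V τ) i := by
  have hadj : ∀ t, 1 ≤ t → ∀ i, 0 < M.adj (U t) (V t) i := fun t ht =>
    h.adj_pos hM hN hμ hμ_lt hS hpull ht
  have hpull' := h.mul_momentPull_pos hM hN hμ hS (s := 1) (by simpa using hpull)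
  obtain ⟨τ₀, hτ₀, hU⟩ := h.exists_forall_nash_lt_U hM hN hμ hS hS₀ hadj fun t ht i => by
    simpa using (hpull' t ht i).le
  refine ⟨τ₀, hτ₀, fun τ hτ i => ?_⟩
  have hτ₁ := hτ₀.trans hτ.le
  calc M.nash < U τ₀ i := hU i
    _ ≤ U τ i := h.monotoneOn_U (fun t ht i => (hadj t ht i).le) i hτ₀ hτ₁ hτ.le
    _ < M.price (U τ) (V τ) i := sub_pos.mp (hadj τ hτ₁ i)

end Limit

end Market

end PriceMoments

theorem mainTheorem1 (M : PriceMoments.Market) (hM : M.Admissible) (N : ℕ) (hN : 2 ≤ N)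
    (μ : Fin N → ℝ) (hμ : μ ∈ M.priceBox N) (σ : Fin N → ℝ) (hσ : ∀ i, 0 < σ i) :
    -- the price-moments ODE has a solution, unique on `[1, ∞)`, ...
    ∃ (U : ℝ → Fin N → ℝ) (V : ℝ → Matrix (Fin N) (Fin N) ℝ),
      M.IsSolution μ (Matrix.diagonal fun i => σ i ^ 2) U V ∧
      (∀ U' V', M.IsSolution μ (Matrix.diagonal fun i => σ i ^ 2) U' V' →
        ∀ τ : ℝ, 1 ≤ τ → U' τ = U τ ∧ V' τ = V τ) ∧
      -- ... and its posted prices satisfy (a) and (b)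
      (μ ∈ M.upperCone N → ∀ τ : ℝ, 1 ≤ τ → ∀ i, M.nash < M.price (U τ) (V τ) i) ∧
      (μ ∈ M.lowerCone N → ∃ τ₀ : ℝ, 1 ≤ τ₀ ∧
        ∀ τ : ℝ, τ₀ < τ → ∀ i, M.nash < M.price (U τ) (V τ) i) := by
  have hS : ∀ i, 0 < Matrix.diagonal (fun i => σ i ^ 2) i i := fun i => by
    rw [Matrix.diagonal_apply_eq]
    exact pow_pos (hσ i) 2
  have hS₀ : ∀ i j, 0 ≤ Matrix.diagonal (fun i => σ i ^ 2) i j := fun i j => by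
    rw [Matrix.diagonal_apply]
    split_ifs <;> positivity
  obtain ⟨U, V, h⟩ := hM.exists_isSolution hN hμ hS
  refine ⟨U, V, h, fun U' V' h' τ hτ => h.unique hM hN hμ hS h' hτ, fun hup τ hτ i => ?_,
    fun hlow => ?_⟩
  · exact h.nash_lt_price_of_momentPull_neg hM hN hμ hS hS₀
      (fun j => hM.momentPull_diagonal_neg_iff.mpr (hup.2 j)) hτ i
  · have hpull i : 0 < M.momentPull μ (Matrix.diagonal fun i => σ i ^ 2) i :=
      hM.momentPull_diagonal_pos_iff.mpr (hlow.2 i)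
    have hμ_nash := hM.lt_nash_of_pull_pos hN fun i =>
      M.momentPull_diagonal μ (fun i => σ i ^ 2) i ▸ hpull i
    exact h.exists_forall_nash_lt_price_of_momentPull_pos hM hN hμ
      (fun i => (hμ_nash i).trans hM.nash_lt_Pmax) hS hS₀ hpull
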